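/- A network has finitely many nodes $i$, with deterministic unknown vectors $x_i\in\mathbb{R}^{n_i}$ ($n_i\ge 1$). Each node has a self measurement $z_i=C_ix_i+v_i$, and some unordered pairs $\{i,j\}$ of distinct nodes have a joint measurement $z_{i,j}=C_{i,j}x_i+C_{j,i}x_j+v_{i,j}$ of dimension at least $1$; these pairs are the edges of the graph $\mathcal{G}$, and $\mathcal{N}_i$ is the set of neighbours of $i$. The noises $v_i$, $v_{i,j}$ have zero mean and finite variance, are mutually uncorrelated, and have covariances $R_i>0$, $R_{i,j}=R_{j,i}>0$. Assume $P_i:=C_i^TR_i^{-1}C_i>0$ for every $i$. The distributed algorithm sets $Q_{j\to i}(0)=0$ and, for $N=1,2,\ldots$, $$Q_i(N)=P_i+\sum_{j\in\mathcal{N}_i}Q_{j\to i}(N-1),\qquad Q_{i\to j}(N)=C_{j,i}^T\Big(R_{i,j}+C_{i,j}\big(Q_i(N)-Q_{j\to i}(N-1)\big)^{-1}C_{i,j}^T\Big)^{-1}C_{j,i}.$$ Let $\mathrm{Cov}_i^{\mathrm{WLS}}$ be the covariance of the estimation error at node $i$ of the centralized weighted least squares estimate of $(x_k)_k$ from all the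 measurements. Let $\|\cdot\|$ be the spectral norm, $\sigma_{\min}$ the smallest singular value, $\bar u=\max_i|\mathcal{N}_i|-1$, $\bar n=\max_i n_i$, and $$\rho=\lambda\sqrt{\bar u},\qquad \lambda=\frac{\alpha_1}{\alpha_1+\beta_1}\cdot\frac{\alpha_2}{\alpha_2+\beta_2},$$ $$\alpha_1=\bar u\max_{i,j}\|C_{i,j}^TR_{i,j}^{-1}C_{i,j}\|,\quad \beta_1=\min_i\sigma_{\min}(P_i),\quad \alpha_2=\max_{i,j}\|C_{i,j}P_i^{-1}C_{i,j}^T\|,\quad \beta_2=\min_{i,j}\sigma_{\min}(R_{i,j}),$$ where $i,j$ range over the adjacent pairs. The loop-free depth $l_1$ of a node, labelled $1$, is the largest integer $l$ such that the subgraph of $\mathcal{G}$ induced on the nodes at distance at most $l$ from node $1$ has no cycle; such a largest integer is assumed to exist (that is, the connected component of node $1$ contains a cycle). Theorem. There is a function $\varpi=\varpi(\bar u,\bar n,\alpha_1,\beta_1,\alpha_2,\beta_2)$ of these six system parameters only (so $\varpi$ does not otherwise depend on the network, nor on $l_1$ or $N$) such that, for every such network with $\rho<1$, every choice of node $1$ with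 loop-free depth $l_1$, and every $N\ge l_1+1$, $$\big\|\mathrm{Cov}_1^{\mathrm{WLS}}-Q_1^{-1}(N)\big\|\le\varpi\,\rho^{\,l_1}.$$ -/

import Mathlib

open Matrix MeasureTheory ProbabilityTheory
open scoped Matrix.Norms.L2Operator

noncomputable section

/-- The smallest singular value of a square matrix. Mathlib lists the singular values in
decreasing order, starting from index `0`. -/
def sigmaMin {k : ℕ} (A : Matrix (Fin k) (Fin k) ℝ) : ℝ :=
  (Matrix.toEuclideanLin A).singularValues (k - 1)

/-- A network of sensing nodes with self measurements `z_i = C_i x_i + v_i` and joint measurements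
`z_{i,j} = C_{i,j} x_i + C_{j,i} x_j + v_{i,j}`. The edges of `graph` are the unordered pairs that
have a joint measurement. Quantities attached to pairs that are not edges are never used. -/
structure SensorNetwork (V : Type*) where
  /-- the canonical graph: `i` and `j` are adjacent iff the joint measurement `z_{i,j}` exists -/
  graph : SimpleGraph V
  /-- the dimension of `x_i` -/
  dim : V → ℕ
  /-- the dimension of `z_i` -/
  selfDim : V → ℕ
  /-- the dimension of `z_{i,j}` -/
  jointDim : Sym2 V → ℕ
  /-- the matrix `C_i` -/
  selfC : (i : V) → Matrix (Fin (selfDim i)) (Fin (dim i)) ℝ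
  /-- the covariance `R_i` -/
  selfR : (i : V) → Matrix (Fin (selfDim i)) (Fin (selfDim i)) ℝ
  /-- for an edge `e = {i, j}`, `jointC e i` is `C_{i,j}` and `jointC e j` is `C_{j,i}` -/
  jointC : (e : Sym2 V) → (i : V) → Matrix (Fin (jointDim e)) (Fin (dim i)) ℝ
  /-- the covariance `R_{i,j}`, for the edge `e = {i, j}` -/
  jointR : (e : Sym2 V) → Matrix (Fin (jointDim e)) (Fin (jointDim e)) ℝ
  dim_pos : ∀ i, 0 < dim i
  jointDim_pos : ∀ e ∈ graph.edgeSet, 0 < jointDim e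
  selfR_posDef : ∀ i, (selfR i).PosDef
  jointR_posDef : ∀ e ∈ graph.edgeSet, (jointR e).PosDef

namespace SensorNetwork

variable {V : Type*} (S : SensorNetwork V)

instance : DecidableRel S.graph.Adj := Classical.decRel _

/-- `C_iᵀ R_i⁻¹ C_i`. -/
def localInfo (i : V) : Matrix (Fin (S.dim i)) (Fin (S.dim i)) ℝ :=
  (S.selfC i)ᵀ * (S.selfR i)⁻¹ * S.selfC i

variable [Fintype V] [DecidableEq V]

/-! ### The distributed algorithm -/

/-- `S.msg N j i` is the information matrix `Q_{j → i}(N)` that node `j` sends to node `i`.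
In the recursion, `Q_j(N+1) = C_jᵀ R_j⁻¹ C_j + ∑_{k ∈ 𝒩_j} Q_{k → j}(N)`,
`R_{j → i}(N+1) = R_{i,j} + C_{j,i} (Q_j(N+1) - Q_{i → j}(N))⁻¹ C_{j,i}ᵀ` and
`Q_{j → i}(N+1) = C_{i,j}ᵀ R_{j → i}(N+1)⁻¹ C_{i,j}`. -/
def msg : ℕ → (j i : V) → Matrix (Fin (S.dim i)) (Fin (S.dim i)) ℝ
  | 0, _, _ => 0
  | N + 1, j, i =>
    (S.jointC s(j, i) i)ᵀ *
      (S.jointR s(j, i) + S.jointC s(j, i) j *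
        ((S.localInfo j + ∑ k ∈ S.graph.neighborFinset j, msg N k j) - msg N i j)⁻¹ *
          (S.jointC s(j, i) j)ᵀ)⁻¹ *
      S.jointC s(j, i) i

/-- The information matrix `Q_i(N) = C_iᵀ R_i⁻¹ C_i + ∑_{j ∈ 𝒩_i} Q_{j → i}(N-1)` at node `i` and
iteration `N = 1, 2, …` of the algorithm. -/
def infoMatrix (i : V) (N : ℕ) : Matrix (Fin (S.dim i)) (Fin (S.dim i)) ℝ :=
  S.localInfo i + ∑ j ∈ S.graph.neighborFinset i, S.msg (N - 1) j i

/-! ### Centralized weighted least squares -/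

/-- Indices of the scalar components of the global state. -/
abbrev Param : Type _ := (i : V) × Fin (S.dim i)

/-- Indices of the scalar components of all the measurements, self and joint. -/
abbrev Row : Type _ :=
  ((i : V) × Fin (S.selfDim i)) ⊕ ((e : S.graph.edgeSet) × Fin (S.jointDim e.1))

/-- The matrix of all the joint measurements, as a function of the global state. -/
def globalJointC : Matrix ((e : S.graph.edgeSet) × Fin (S.jointDim e.1)) S.Param ℝ :=
  Matrix.of fun p q => if q.1 ∈ p.1.1 then S.jointC p.1.1 q.1 p.2 q.2 else 0

/-- The matrix of all the measurements, as a function of the global state. -/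
def globalC : Matrix S.Row S.Param ℝ :=
  Matrix.fromRows (Matrix.blockDiagonal' S.selfC) S.globalJointC

/-- The covariance of the noise of all the measurements: noises of different measurements are
uncorrelated. -/
def globalR : Matrix S.Row S.Row ℝ :=
  Matrix.fromBlocks (Matrix.blockDiagonal' S.selfR) 0 0
    (Matrix.blockDiagonal' fun e : S.graph.edgeSet => S.jointR e.1)

/-- `v` is a measurement noise of the network: it is centred, of finite variance, the noises
`v_i`, `v_{i,j}` have covariances `R_i`, `R_{i,j}`, and different ones are uncorrelated (as they
are when they are independent). -/
structure IsNoise {Ω : Type*} [MeasurableSpace Ω] (P : Measure Ω) (v : S.Row → Ω → ℝ) : Prop where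
  memLp : ∀ a, MemLp (v a) 2 P
  mean_eq_zero : ∀ a, ∫ ω, v a ω ∂P = 0
  cov_eq : ∀ a b, cov[v a, v b; P] = S.globalR a b

/-- The measurements of the global state `x` under the noise `v`. -/
def measurement {Ω : Type*} (x : S.Param → ℝ) (v : S.Row → Ω → ℝ) (ω : Ω) : S.Row → ℝ :=
  S.globalC *ᵥ x + fun a => v a ω

/-- The centralized weighted least squares estimate of the global state from all the measurements,
i.e. the minimizer of `(z - C x)ᵀ R⁻¹ (z - C x)`. -/
def wlsEstimate (z : S.Row → ℝ) : S.Param → ℝ :=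
  (S.globalCᵀ * S.globalR⁻¹ * S.globalC)⁻¹ *ᵥ (S.globalCᵀ *ᵥ (S.globalR⁻¹ *ᵥ z))

/-- The covariance matrix of the estimation error at node `i` of centralized weighted least
squares. -/
def wlsCov {Ω : Type*} [MeasurableSpace Ω] (P : Measure Ω) (x : S.Param → ℝ) (v : S.Row → Ω → ℝ)
    (i : V) : Matrix (Fin (S.dim i)) (Fin (S.dim i)) ℝ :=
  Matrix.of fun a b =>
    cov[fun ω => S.wlsEstimate (S.measurement x v ω) ⟨i, a⟩ - x ⟨i, a⟩,
      fun ω => S.wlsEstimate (S.measurement x v ω) ⟨i, b⟩ - x ⟨i, b⟩; P]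

/-! ### System constants -/

/-- `ū = max_i |𝒩_i| - 1`. -/
def uBar : ℝ := (S.graph.maxDegree : ℝ) - 1

/-- `n̄ = max_i dim x_i`. -/
def nBar : ℕ := Finset.univ.sup S.dim

/-- `α₁ = ū max_{i,j} ‖C_{i,j}ᵀ R_{i,j}⁻¹ C_{i,j}‖`. The maximum is over the adjacent ordered pairs
`(i, j)`, and the norm is the spectral norm. -/
def alpha₁ : ℝ :=
  S.uBar * ⨆ d : S.graph.Dart,
    ‖(S.jointC d.edge d.fst)ᵀ * (S.jointR d.edge)⁻¹ * S.jointC d.edge d.fst‖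

/-- `β₁ = min_i σ_min(C_iᵀ R_i⁻¹ C_i)`. -/
def beta₁ : ℝ := ⨅ i : V, sigmaMin (S.localInfo i)

/-- `α₂ = max_{i,j} ‖C_{i,j} (C_iᵀ R_i⁻¹ C_i)⁻¹ C_{i,j}ᵀ‖`. -/
def alpha₂ : ℝ :=
  ⨆ d : S.graph.Dart,
    ‖S.jointC d.edge d.fst * (S.localInfo d.fst)⁻¹ * (S.jointC d.edge d.fst)ᵀ‖

/-- `β₂ = min_{i,j} σ_min(R_{i,j})`. -/
def beta₂ : ℝ := ⨅ e : S.graph.edgeSet, sigmaMin (S.jointR e.1)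

/-- `λ = α₁ / (α₁ + β₁) * (α₂ / (α₂ + β₂))`. -/
def lam : ℝ := S.alpha₁ / (S.alpha₁ + S.beta₁) * (S.alpha₂ / (S.alpha₂ + S.beta₂))

/-- `ρ = λ √ū`. -/
def rho : ℝ := S.lam * √S.uBar

/-- `l` is the loop-free depth of node `i`: the largest `l` for which the subgraph formed by the
nodes at distance at most `l` from `i` has no cycles. -/
def IsLoopFreeDepth (i : V) (l : ℕ) : Prop :=
  IsGreatest {k : ℕ | (S.graph.induce {j | S.graph.edist i j ≤ k}).IsAcyclic} l

end SensorNetwork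

end

/-! The ball of radius `l` around the root is a tree, and what happens outside it can influence the
root only through its leaves. Two recursions on this tree (`subtreeInfo`) bracket every possibility:
one gives the leaves no information from outside, the other (`outerInfo`) treats their outer
neighbours as exactly known.

A message is a partial minimum of a quadratic cost, so it is monotone in the information it carries.
Hence `Q_r(N)` lies between the two recursions once `N ≥ l + 1` (`UniqueInner.subtreeInfo_quad_le`).
The inverse of the covariance block of weighted least squares lies there too: eliminating the tree
level by level turns the global cost into the same recursions (`UniqueInner.globalInfo_inv_quad_le`,
`UniqueInner.le_globalInfo_inv_quad`).

The recursions forget their leaves geometrically (`UniqueInner.subtreeInfo_outerInfo_quad_le`). If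
the upper one is at most `1 + ε` times the lower one at the children, then passing through the joint
measurement shrinks `ε` by `α₂ / (α₂ + β₂)`, because the noise `R` is unaffected, and adding the
common local information shrinks it by `α₁ / (α₁ + β₁)`. Together this is `λ` per level, starting
from `α₁ / β₁`.

Inverting, the covariance and `Q_r(N)⁻¹` lie in a common interval of length at most `ε / β₁`. This
gives the rate `λ`, and `λ ≤ ρ` since a cycle forces `ū ≥ 1`. -/

set_option linter.unusedSectionVars false

noncomputable section

/-! ### Quadratic forms -/

namespace Matrix

variable {m n : Type*} [Fintype m] [Fintype n]

/-- The quadratic form `x ↦ xᵀ A x`. -/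
def quad (A : Matrix n n ℝ) (x : n → ℝ) : ℝ := x ⬝ᵥ A *ᵥ x

@[simp] lemma quad_zero (A : Matrix n n ℝ) : A.quad 0 = 0 := by simp [quad]

@[simp] lemma zero_quad (x : n → ℝ) : (0 : Matrix n n ℝ).quad x = 0 := by simp [quad]

lemma add_quad (A B : Matrix n n ℝ) (x : n → ℝ) : (A + B).quad x = A.quad x + B.quad x := by
  simp [quad, add_mulVec]

lemma sub_quad (A B : Matrix n n ℝ) (x : n → ℝ) : (A - B).quad x = A.quad x - B.quad x := by
  simp [quad, sub_mulVec]

lemma sum_quad {ι : Type*} (s : Finset ι) (A : ι → Matrix n n ℝ) (x : n → ℝ) :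
    (∑ i ∈ s, A i).quad x = ∑ i ∈ s, (A i).quad x := by
  simp only [quad, sum_mulVec, dotProduct_sum]

lemma quad_neg (A : Matrix n n ℝ) (x : n → ℝ) : A.quad (-x) = A.quad x := by
  simp [quad, mulVec_neg]

lemma transpose_mul_mul_quad (A : Matrix m m ℝ) (C : Matrix m n ℝ) (x : n → ℝ) :
    (Cᵀ * A * C).quad x = A.quad (C *ᵥ x) := by
  rw [quad, quad, ← mulVec_mulVec, ← mulVec_mulVec, mulVec_transpose, dotProduct_comm,
    ← dotProduct_mulVec, dotProduct_comm]

lemma dotProduct_mulVec_comm {A : Matrix n n ℝ} (hA : A.IsHermitian) (x y : n → ℝ) :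
    x ⬝ᵥ A *ᵥ y = y ⬝ᵥ A *ᵥ x := by
  rw [dotProduct_mulVec, ← mulVec_transpose, dotProduct_comm, ← conjTranspose_eq_transpose_of_trivial,
    hA.eq]

lemma quad_add {A : Matrix n n ℝ} (hA : A.IsHermitian) (x y : n → ℝ) :
    A.quad (x + y) = A.quad x + 2 * (y ⬝ᵥ A *ᵥ x) + A.quad y := by
  simp only [quad, mulVec_add, add_dotProduct, dotProduct_add]
  rw [dotProduct_mulVec_comm hA x y]
  ring

lemma PosSemidef.quad_nonneg {A : Matrix n n ℝ} (hA : A.PosSemidef) (x : n → ℝ) :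
    0 ≤ A.quad x := by
  exact hA.dotProduct_mulVec_nonneg x

lemma PosDef.quad_nonneg {A : Matrix n n ℝ} (hA : A.PosDef) (x : n → ℝ) : 0 ≤ A.quad x :=
  hA.posSemidef.quad_nonneg x

lemma PosSemidef.transpose_mul_mul_same {A : Matrix m m ℝ} (hA : A.PosSemidef) (B : Matrix m n ℝ) :
    (Bᵀ * A * B).PosSemidef := by
  simpa using hA.conjTranspose_mul_mul_same B

lemma PosSemidef.mul_mul_transpose_same {A : Matrix n n ℝ} (hA : A.PosSemidef) (B : Matrix m n ℝ) :
    (B * A * Bᵀ).PosSemidef := by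
  simpa using hA.mul_mul_conjTranspose_same B

lemma mul_mul_transpose_quad (A : Matrix n n ℝ) (C : Matrix m n ℝ) (x : m → ℝ) :
    (C * A * Cᵀ).quad x = A.quad (Cᵀ *ᵥ x) := by
  simpa using transpose_mul_mul_quad A Cᵀ x

variable [DecidableEq n]

lemma PosDef.mulVec_inv_mulVec {A : Matrix n n ℝ} (hA : A.PosDef) (x : n → ℝ) :
    A *ᵥ A⁻¹ *ᵥ x = x := by
  rw [mulVec_mulVec, mul_nonsing_inv _ ((isUnit_iff_isUnit_det _).1 hA.isUnit), one_mulVec]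

lemma PosDef.inv_mulVec_mulVec {A : Matrix n n ℝ} (hA : A.PosDef) (x : n → ℝ) :
    A⁻¹ *ᵥ A *ᵥ x = x := by
  rw [mulVec_mulVec, nonsing_inv_mul _ ((isUnit_iff_isUnit_det _).1 hA.isUnit), one_mulVec]

lemma PosDef.quad_inv_mulVec {A : Matrix n n ℝ} (hA : A.PosDef) (x : n → ℝ) :
    A.quad (A⁻¹ *ᵥ x) = A⁻¹.quad x := by
  rw [quad, quad, hA.mulVec_inv_mulVec, dotProduct_comm]

lemma PosDef.inv_quad_mulVec {A : Matrix n n ℝ} (hA : A.PosDef) (x : n → ℝ) :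
    A⁻¹.quad (A *ᵥ x) = A.quad x := by
  rw [quad, quad, hA.inv_mulVec_mulVec, dotProduct_comm]

/-- The Fenchel inequality for a positive definite quadratic form. -/
lemma PosDef.two_mul_dotProduct_sub_quad_le {A : Matrix n n ℝ} (hA : A.PosDef) (x y : n → ℝ) :
    2 * (x ⬝ᵥ y) - A.quad y ≤ A⁻¹.quad x := by
  have h := hA.quad_nonneg (-(A⁻¹ *ᵥ x) + y)
  rw [quad_add hA.isHermitian, quad_neg, hA.quad_inv_mulVec, mulVec_neg, hA.mulVec_inv_mulVec,
    dotProduct_neg, dotProduct_comm] at h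
  linarith

/-- The equality case of the Fenchel inequality. Together they express the inverse form as a
maximum, which is how all inverses below are compared. -/
lemma PosDef.two_mul_dotProduct_inv_sub_quad {A : Matrix n n ℝ} (hA : A.PosDef) (x : n → ℝ) :
    2 * (x ⬝ᵥ A⁻¹ *ᵥ x) - A.quad (A⁻¹ *ᵥ x) = A⁻¹.quad x := by
  rw [hA.quad_inv_mulVec, quad]
  ring

lemma PosDef.inv_quad_le_inv_quad {A B : Matrix n n ℝ} (hA : A.PosDef) (hB : B.PosDef)
    (h : ∀ x, A.quad x ≤ B.quad x) (x : n → ℝ) : B⁻¹.quad x ≤ A⁻¹.quad x := by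
  rw [← hB.two_mul_dotProduct_inv_sub_quad]
  have h₁ := hA.two_mul_dotProduct_sub_quad_le x (B⁻¹ *ᵥ x)
  linarith [h (B⁻¹ *ᵥ x)]

/-- If `A ≤ B ≤ (1 + ε) A` then `A⁻¹ - B⁻¹ ≤ ε A⁻¹`. -/
lemma PosDef.inv_quad_sub_inv_quad_le {A B : Matrix n n ℝ} (hA : A.PosDef) (hB : B.PosDef)
    {ε : ℝ} (hε : 0 ≤ ε) (h : ∀ x, B.quad x ≤ (1 + ε) * A.quad x) (x : n → ℝ) :
    A⁻¹.quad x - B⁻¹.quad x ≤ ε * A⁻¹.quad x := by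
  have hpos : 0 < 1 + ε := by linarith
  have hd : x ⬝ᵥ A⁻¹ *ᵥ x = A⁻¹.quad x := rfl
  have hq := hA.inv.quad_nonneg x
  -- The scale `1 - ε` replaces the optimal `1 / (1 + ε)`. It gives `B⁻¹ ≥ (1 - ε + ε² (1 - ε))
  -- A⁻¹`, which suffices for `ε ≤ 1`; for larger `ε` the bound `B⁻¹ ≥ 0` is enough.
  have h₁ := hB.two_mul_dotProduct_sub_quad_le x ((1 - ε) • A⁻¹ *ᵥ x)
  have h₂ := h ((1 - ε) • A⁻¹ *ᵥ x)
  have h₃ : A.quad ((1 - ε) • A⁻¹ *ᵥ x) = (1 - ε) ^ 2 * A⁻¹.quad x := by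
    rw [← hA.quad_inv_mulVec]
    simp only [quad, mulVec_smul, smul_dotProduct, dotProduct_smul, smul_eq_mul]
    ring
  rw [h₃] at h₂
  rw [dotProduct_smul, smul_eq_mul, hd] at h₁
  by_cases hε1 : ε ≤ 1
  · have : 0 ≤ ε ^ 2 * (1 - ε) * A⁻¹.quad x := by
      have : 0 ≤ 1 - ε := by linarith
      positivity
    nlinarith
  · have := hB.inv.quad_nonneg x
    nlinarith

/-! ### Messages as partial minima of quadratic costs. -/

/-- The minimum over `z` of `zᵀ M z + (C' x + C z)ᵀ R⁻¹ (C' x + C z)`, as a quadratic form in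
`x`. -/
def message {k : Type*} [Fintype k] [DecidableEq k] (R : Matrix k k ℝ) (C' : Matrix k m ℝ)
    (C : Matrix k n ℝ) (M : Matrix n n ℝ) : Matrix m m ℝ :=
  C'ᵀ * (R + C * M⁻¹ * Cᵀ)⁻¹ * C'

section message

variable {k : Type*} [Fintype k] {R : Matrix k k ℝ} {C' : Matrix k m ℝ} {C : Matrix k n ℝ}
  {M : Matrix n n ℝ}

lemma PosDef.add_mul_inv_mul_transpose (hR : R.PosDef) (hM : M.PosDef) (C : Matrix k n ℝ) :
    (R + C * M⁻¹ * Cᵀ).PosDef :=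
  hR.add_posSemidef (hM.inv.posSemidef.mul_mul_transpose_same C)

variable [DecidableEq k]

lemma message_posSemidef (hR : R.PosDef) (hM : M.PosDef) :
    (message R C' C M).PosSemidef :=
  (hR.add_mul_inv_mul_transpose hM C).inv.posSemidef.transpose_mul_mul_same C'

/-- The minimizer of the quadratic form that defines the message. -/
def messageArg (R : Matrix k k ℝ) (C' : Matrix k m ℝ) (C : Matrix k n ℝ) (M : Matrix n n ℝ)
    (x : m → ℝ) : n → ℝ :=
  -(M⁻¹ *ᵥ Cᵀ *ᵥ (R + C * M⁻¹ * Cᵀ)⁻¹ *ᵥ C' *ᵥ x)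

lemma mulVec_add_mulVec_messageArg (hR : R.PosDef) (hM : M.PosDef) (x : m → ℝ) :
    C' *ᵥ x + C *ᵥ messageArg R C' C M x = R *ᵥ (R + C * M⁻¹ * Cᵀ)⁻¹ *ᵥ C' *ᵥ x := by
  set u := (R + C * M⁻¹ * Cᵀ)⁻¹ *ᵥ C' *ᵥ x with hu
  have h : C' *ᵥ x = R *ᵥ u + C *ᵥ M⁻¹ *ᵥ Cᵀ *ᵥ u := by
    rw [← (hR.add_mul_inv_mul_transpose hM C).mulVec_inv_mulVec (C' *ᵥ x), ← hu, add_mulVec]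
    simp only [mulVec_mulVec, Matrix.mul_assoc]
  rw [messageArg, ← hu, mulVec_neg, h]
  abel

lemma quad_messageArg (hM : M.PosDef) (x : m → ℝ) :
    M.quad (messageArg R C' C M x) =
      (C * M⁻¹ * Cᵀ).quad ((R + C * M⁻¹ * Cᵀ)⁻¹ *ᵥ C' *ᵥ x) := by
  rw [messageArg, quad_neg, hM.quad_inv_mulVec, mul_mul_transpose_quad]

lemma message_quad_eq_quad (hR : R.PosDef) (hM : M.PosDef) (x : m → ℝ) :
    (message R C' C M).quad x =
      (R + C * M⁻¹ * Cᵀ).quad ((R + C * M⁻¹ * Cᵀ)⁻¹ *ᵥ C' *ᵥ x) := by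
  rw [message, transpose_mul_mul_quad, (hR.add_mul_inv_mul_transpose hM C).quad_inv_mulVec]

/-- With `u = (R + C M⁻¹ Cᵀ)⁻¹ C' x`, the prior cost at the minimizer is the `C M⁻¹ Cᵀ` part of the
form at `u` and the measurement cost is the `R` part. -/
lemma message_quad_eq (hR : R.PosDef) (hM : M.PosDef) (x : m → ℝ) :
    M.quad (messageArg R C' C M x) + R⁻¹.quad (C' *ᵥ x + C *ᵥ messageArg R C' C M x) =
      (message R C' C M).quad x := by
  rw [quad_messageArg hM, mulVec_add_mulVec_messageArg hR hM, hR.inv_quad_mulVec,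
    message_quad_eq_quad hR hM, add_quad, add_comm]

/-- Expanding around `messageArg`, the two cross terms cancel by stationarity and the second-order
terms are nonnegative. -/
lemma message_quad_le (hR : R.PosDef) (hM : M.PosDef) (x : m → ℝ) (z : n → ℝ) :
    (message R C' C M).quad x ≤ M.quad z + R⁻¹.quad (C' *ᵥ x + C *ᵥ z) := by
  obtain ⟨d, rfl⟩ : ∃ d, z = messageArg R C' C M x + d := ⟨z - messageArg R C' C M x, by abel⟩
  rw [← message_quad_eq hR hM, mulVec_add, ← add_assoc, quad_add hM.isHermitian,
    quad_add hR.inv.isHermitian _ (C *ᵥ d), mulVec_add_mulVec_messageArg hR hM, hR.inv_mulVec_mulVec]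
  set u := (R + C * M⁻¹ * Cᵀ)⁻¹ *ᵥ C' *ᵥ x with hu
  have h₁ : d ⬝ᵥ M *ᵥ messageArg R C' C M x = -(C *ᵥ d ⬝ᵥ u) := by
    rw [messageArg, ← hu, mulVec_neg, hM.mulVec_inv_mulVec, dotProduct_neg, mulVec_transpose,
      dotProduct_comm, ← dotProduct_mulVec, dotProduct_comm]
  have := hM.quad_nonneg d
  have := hR.inv.quad_nonneg (C *ᵥ d)
  rw [h₁]
  linarith

lemma message_quad_le_of_known (hR : R.PosDef) (hM : M.PosDef) (x : m → ℝ) :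
    (message R C' C M).quad x ≤ (C'ᵀ * R⁻¹ * C').quad x := by
  simpa [transpose_mul_mul_quad] using message_quad_le (C' := C') (C := C) hR hM x 0

lemma message_quad_mono {M' : Matrix n n ℝ} (hR : R.PosDef) (hM : M.PosDef) (hM' : M'.PosDef)
    (h : ∀ z, M.quad z ≤ M'.quad z) (x : m → ℝ) :
    (message R C' C M).quad x ≤ (message R C' C M').quad x := by
  rw [← message_quad_eq hR hM']
  exact (message_quad_le hR hM x _).trans (by gcongr; exact h _)

/-- A relative change `ε` of `M` changes the message by at most the factor `1 + s ε`, if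
`C M⁻¹ Cᵀ` makes up at most the fraction `s` of `R + C M⁻¹ Cᵀ`. -/
lemma message_quad_le_one_add_mul {M' : Matrix n n ℝ} (hR : R.PosDef) (hM : M.PosDef)
    (hM' : M'.PosDef) {ε s : ℝ} (hε : 0 ≤ ε) (h : ∀ z, M'.quad z ≤ (1 + ε) * M.quad z)
    (hs : ∀ u, (C * M⁻¹ * Cᵀ).quad u ≤ s * (R + C * M⁻¹ * Cᵀ).quad u) (x : m → ℝ) :
    (message R C' C M').quad x ≤ (1 + s * ε) * (message R C' C M).quad x := by
  -- The minimizer for `M` is used as a trial point for `M'`. Only its prior cost grows by `ε`, and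
  -- that is at most the fraction `s` of the total.
  have h₁ := message_quad_le (C' := C') (C := C) hR hM' x (messageArg R C' C M x)
  have h₂ := h (messageArg R C' C M x)
  have h₃ := message_quad_eq (C' := C') (C := C) hR hM x
  have h₄ : M.quad (messageArg R C' C M x) ≤ s * (message R C' C M).quad x := by
    rw [quad_messageArg hM, message_quad_eq_quad hR hM]
    exact hs _
  nlinarith [mul_le_mul_of_nonneg_left h₄ hε]

end message

end Matrix

/-! ### Spectral norm and smallest singular value through quadratic forms. -/

namespace Matrix

section norm

variable {n : Type*} [Fintype n]

lemma dotProduct_self_eq_norm_sq (x : n → ℝ) : x ⬝ᵥ x = ‖WithLp.toLp 2 x‖ ^ 2 := by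
  rw [EuclideanSpace.real_norm_sq_eq]
  simp [dotProduct, sq]

variable [DecidableEq n]

lemma dotProduct_mulVec_eq_inner (A : Matrix n n ℝ) (x y : n → ℝ) :
    x ⬝ᵥ A *ᵥ y = inner ℝ (toEuclideanCLM (n := n) (𝕜 := ℝ) A (WithLp.toLp 2 y)) (WithLp.toLp 2 x) := by
  simp [toEuclideanCLM_toLp, EuclideanSpace.inner_toLp_toLp]

lemma quad_le_norm_mul (A : Matrix n n ℝ) (x : n → ℝ) : A.quad x ≤ ‖A‖ * (x ⬝ᵥ x) := by
  rw [quad, dotProduct_mulVec_eq_inner, dotProduct_self_eq_norm_sq, cstar_norm_def, sq, ← mul_assoc]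
  refine (real_inner_le_norm _ _).trans ?_
  gcongr
  exact ContinuousLinearMap.le_opNorm _ _

lemma IsHermitian.norm_le_of_abs_quad_le {A : Matrix n n ℝ} (hA : A.IsHermitian) {c : ℝ}
    (hc : 0 ≤ c) (h : ∀ x, |A.quad x| ≤ c * (x ⬝ᵥ x)) : ‖A‖ ≤ c := by
  have key (x y : n → ℝ) : 2 * (x ⬝ᵥ A *ᵥ y) ≤ c * (x ⬝ᵥ x + y ⬝ᵥ y) := by
    have h₁ := (abs_le.1 (h (y + x))).2
    have h₂ := (abs_le.1 (h (y + -x))).1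
    rw [quad_add hA] at h₁ h₂
    rw [quad_neg] at h₂
    simp only [add_dotProduct, dotProduct_add, neg_dotProduct, dotProduct_neg] at h₁ h₂
    linarith
  rw [cstar_norm_def]
  refine ContinuousLinearMap.opNorm_le_of_unit_norm hc fun x hx => ?_
  set z := toEuclideanCLM (n := n) (𝕜 := ℝ) A x with hz
  by_cases hz0 : ‖z‖ = 0
  · rwa [hz0]
  have hpos : 0 < ‖z‖ := lt_of_le_of_ne (norm_nonneg _) (Ne.symm hz0)
  -- Pairing `A x` with its own direction gives `2 ‖z‖ ≤ c (1 + 1)` for a unit vector `x`.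
  have := key (‖z‖⁻¹ • z.ofLp) x.ofLp
  rw [dotProduct_mulVec_eq_inner, dotProduct_self_eq_norm_sq, dotProduct_self_eq_norm_sq] at this
  simp only [WithLp.toLp_smul, WithLp.toLp_ofLp, ← hz, norm_smul, hx, inner_smul_right,
    real_inner_self_eq_norm_sq, norm_inv, norm_norm, inv_mul_cancel₀ hz0] at this
  have h₂ : ‖z‖⁻¹ * ‖z‖ ^ 2 = ‖z‖ := by field_simp
  rw [h₂] at this
  linarith

end norm

end Matrix

section sigmaMin

variable {k : ℕ} {A : Matrix (Fin k) (Fin k) ℝ}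

lemma sigmaMin_pos (hk : 0 < k) (hA : A.PosDef) : 0 < sigmaMin A := by
  refine (LinearMap.injective_iff_forall_lt_finrank_singularValues_pos _).1 ?_ (k - 1)
    (by rw [finrank_euclideanSpace_fin]; omega)
  intro x y h
  have h' : A *ᵥ x.ofLp = A *ᵥ y.ofLp :=
    congrArg WithLp.ofLp h
  have := congrArg (A⁻¹ *ᵥ ·) h'
  simp only [hA.inv_mulVec_mulVec] at this
  exact WithLp.ofLp_injective 2 this

/-- The vector `v` is an eigenvector of `A* A = A²` for `c²`, so `c²` is the square of some singular
value, and the last one is the smallest. -/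
lemma sigmaMin_le_of_mulVec_eq (hA : A.IsHermitian) {c : ℝ} (hc : 0 ≤ c) {v : Fin k → ℝ}
    (hv : v ≠ 0) (h : A *ᵥ v = c • v) : sigmaMin A ≤ c := by
  set T := Matrix.toEuclideanLin A with hT
  have hadj : LinearMap.adjoint T = T := by
    rw [hT, ← Matrix.toEuclideanLin_conjTranspose_eq_adjoint, hA.eq]
  have hTv : T (WithLp.toLp 2 v) = c • WithLp.toLp 2 v := by
    simp [hT, h]
  have hk : 0 < k := by
    rcases Nat.eq_zero_or_pos k with rfl | hk
    · exact absurd (Subsingleton.elim v 0) hv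
    · exact hk
  have hn : Module.finrank ℝ (EuclideanSpace ℝ (Fin k)) = k := finrank_euclideanSpace_fin
  have hev : Module.End.HasEigenvalue (LinearMap.adjoint T ∘ₗ T) (c ^ 2) := by
    refine Module.End.hasEigenvalue_of_hasEigenvector (x := WithLp.toLp 2 v) ⟨?_, ?_⟩
    · rw [Module.End.mem_eigenspace_iff, hadj, LinearMap.comp_apply, hTv, map_smul, hTv, smul_smul,
        sq]
    · simpa using hv
  obtain ⟨i, hi⟩ := T.isSymmetric_adjoint_comp_self.exists_eigenvalues_eq hn hev
  have hle := T.singularValues_antitone (show (i : ℕ) ≤ k - 1 by have := i.2; omega)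
  refine hle.trans ?_
  refine le_of_sq_le_sq ?_ hc
  rw [T.sq_singularValues_fin hn]
  exact le_of_eq hi

/-- An eigenvector of `A - σ_min` is one of `A`, whose eigenvalue is nonnegative and hence at least
`σ_min`; so the difference is positive semidefinite. -/
lemma sigmaMin_mul_le_quad (hA : A.PosDef) (x : Fin k → ℝ) : sigmaMin A * (x ⬝ᵥ x) ≤ A.quad x := by
  have hB : (A - sigmaMin A • 1).IsHermitian := by
    refine hA.isHermitian.sub ?_
    simp [IsHermitian]
  have hP : (A - sigmaMin A • 1).PosSemidef := by
    rw [hB.posSemidef_iff_eigenvalues_nonneg]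
    intro j
    set v : Fin k → ℝ := (hB.eigenvectorBasis j).ofLp with hv
    have hv0 : v ≠ 0 := fun h0 => hB.eigenvectorBasis.orthonormal.ne_zero j (by
      apply WithLp.ofLp_injective 2; rw [← hv, h0]; rfl)
    have hAv : A *ᵥ v = (hB.eigenvalues j + sigmaMin A) • v := by
      have := hB.mulVec_eigenvectorBasis j
      rw [sub_mulVec, smul_mulVec, one_mulVec, sub_eq_iff_eq_add] at this
      rw [add_smul]
      exact this
    have hpos : 0 ≤ hB.eigenvalues j + sigmaMin A := by
      have hq := hA.quad_nonneg v
      have hvv : 0 < v ⬝ᵥ v := by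
        simpa using dotProduct_star_self_pos_iff.2 hv0
      rw [quad, hAv, dotProduct_smul, smul_eq_mul] at hq
      exact nonneg_of_mul_nonneg_left hq hvv
    have := sigmaMin_le_of_mulVec_eq hA.isHermitian hpos hv0 hAv
    simp only [Pi.zero_apply]
    linarith
  have := hP.quad_nonneg x
  rw [sub_quad] at this
  simp only [quad, smul_mulVec, one_mulVec, dotProduct_smul, smul_eq_mul] at this ⊢
  linarith

end sigmaMin

/-! ### Loop-free neighbourhoods -/

namespace SimpleGraph

variable {V : Type*} {G : SimpleGraph V}

lemma edist_le_edist_add_one_of_adj {r j k : V} (h : G.Adj j k) : G.edist r k ≤ G.edist r j + 1 :=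
  G.edist_triangle.trans (by rw [edist_eq_one_iff_adj.2 h])

lemma exists_adj_edist_eq {r v : V} {d : ℕ} (h : G.edist r v = (d + 1 : ℕ)) :
    ∃ w, G.Adj v w ∧ G.edist r w = d := by
  rw [edist_comm] at h
  obtain ⟨p, hp⟩ := exists_walk_of_edist_eq_coe h
  cases p with
  | nil => simp at hp
  | @cons _ w _ hadj q =>
    refine ⟨w, hadj, le_antisymm ?_ ?_⟩
    · rw [edist_comm]
      exact (edist_le q).trans (by simpa using hp.le)
    · have := edist_le_edist_add_one_of_adj (r := r) hadj.symm
      rw [edist_comm, h] at this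
      push_cast at this
      exact (ENat.add_le_add_iff_right (by simp)).1 this

/-- A shortest path to `r` from a node at distance at most `l`. -/
lemma exists_isPath_induce_edist_le {r : V} {l d : ℕ} (hd : d ≤ l)
    (hr : r ∈ {j | G.edist r j ≤ l}) {v : V} (hv : v ∈ {j | G.edist r j ≤ l})
    (h : G.edist r v = d) :
    ∃ p : (G.induce {j | G.edist r j ≤ l}).Walk ⟨v, hv⟩ ⟨r, hr⟩,
      p.IsPath ∧ ∀ w ∈ p.support, w.1 ≠ v → G.edist r w.1 < d := by
  induction d generalizing v with
  | zero =>
    obtain rfl : r = v := by simpa using h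
    exact ⟨.nil, .nil, by simp⟩
  | succ d ih =>
    obtain ⟨w, hadj, hw⟩ := exists_adj_edist_eq h
    have hwl : w ∈ {j | G.edist r j ≤ l} := by
      rw [Set.mem_ofPred_eq, hw]
      exact_mod_cast (by omega : d ≤ l)
    obtain ⟨p, hp, hsupp⟩ := ih (by omega) hwl hw
    have hlt : ∀ u ∈ p.support, G.edist r u.1 < (d + 1 : ℕ) := by
      intro u hu
      by_cases huw : u.1 = w
      · rw [huw, hw]
        exact_mod_cast Nat.lt_succ_self d
      · exact (hsupp u hu huw).trans (by exact_mod_cast Nat.lt_succ_self d)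
    refine ⟨.cons (show (G.induce _).Adj ⟨v, hv⟩ ⟨w, hwl⟩ from hadj) p, ?_, ?_⟩
    · rw [Walk.cons_isPath_iff]
      refine ⟨hp, fun hmem => ?_⟩
      have := hlt _ hmem
      rw [h] at this
      exact lt_irrefl _ this
    · intro u hu huv
      rw [Walk.support_cons, List.mem_cons] at hu
      rcases hu with rfl | hu
      · exact absurd rfl huv
      · exact hlt u hu

/-- Shortest paths from `k` and `k'` to `r` avoid `v`, because their later vertices are strictly
closer to `r`. Prefixed by `v` they are two paths from `v` to `r` in an acyclic graph, so they
coincide and have the same second vertex. -/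
lemma eq_of_adj_of_edist_le_of_isAcyclic {r : V} {l : ℕ}
    (hG : (G.induce {j | G.edist r j ≤ l}).IsAcyclic) {v k k' : V} (hv : G.edist r v ≤ l)
    (hk : G.Adj v k) (hk' : G.Adj v k') (hkd : G.edist r k ≤ G.edist r v)
    (hkd' : G.edist r k' ≤ G.edist r v) : k = k' := by
  have hr : r ∈ {j | G.edist r j ≤ l} := by simp
  have key {u : V} (hu : G.Adj v u) (hud : G.edist r u ≤ G.edist r v) :
      ∃ p : (G.induce {j | G.edist r j ≤ l}).Walk ⟨u, hud.trans hv⟩ ⟨r, hr⟩,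
        (Walk.cons (show (G.induce {j | G.edist r j ≤ l}).Adj ⟨v, hv⟩ ⟨u, hud.trans hv⟩ from hu)
          p).IsPath := by
    obtain ⟨d, hd⟩ := ENat.ne_top_iff_exists.1 (ne_top_of_le_ne_top (ENat.natCast_ne_top l)
      (hud.trans hv))
    have hdl : d ≤ l := by
      have := hud.trans hv
      rw [← hd] at this
      exact_mod_cast this
    obtain ⟨p, hp, hsupp⟩ := exists_isPath_induce_edist_le hdl hr (hud.trans hv) hd.symm
    refine ⟨p, (Walk.cons_isPath_iff _ _).2 ⟨hp, fun hmem => ?_⟩⟩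
    have := hsupp _ hmem hu.ne
    rw [hd] at this
    exact absurd hud (not_le.2 this)
  obtain ⟨p, hp⟩ := key hk hkd
  obtain ⟨p', hp'⟩ := key hk' hkd'
  have h := congrArg (fun q : (G.induce {j | G.edist r j ≤ l}).Path ⟨v, hv⟩ ⟨r, hr⟩ => q.1.snd.1)
    ((hG.subsingleton_path _ _).elim ⟨_, hp⟩ ⟨_, hp'⟩)
  simpa using h

lemma two_le_maxDegree_of_not_isAcyclic [Fintype V] [DecidableRel G.Adj] (h : ¬G.IsAcyclic) :
    2 ≤ G.maxDegree := by
  simp only [IsAcyclic, not_forall, not_not] at h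
  obtain ⟨v, c, hc⟩ := h
  refine le_trans ?_ (G.degree_le_maxDegree v)
  rw [← hc.ncard_neighborSet_toSubgraph_eq_two c.start_mem_support, ← card_neighborSet_eq_degree,
    ← Nat.card_eq_fintype_card,
    Nat.card_coe_set_eq]
  exact Set.ncard_le_ncard (c.toSubgraph.neighborSet_subset v) (Set.toFinite _)

end SimpleGraph

/-! ### The information carried by a single edge. -/

namespace SensorNetwork

variable {V : Type*} (S : SensorNetwork V)

/-- The information on the state of node `i` in the joint measurement of the edge `e`, when the
state of the other node of `e` is known. -/
def edgeInfo (e : Sym2 V) (i : V) : Matrix (Fin (S.dim i)) (Fin (S.dim i)) ℝ :=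
  (S.jointC e i)ᵀ * (S.jointR e)⁻¹ * S.jointC e i

/-- The information on the state of node `i` in the joint measurement of the edge `{k, i}`, when
there is the information `M` on the state of node `k`. -/
def edgeMsg (k i : V) (M : Matrix (Fin (S.dim k)) (Fin (S.dim k)) ℝ) :
    Matrix (Fin (S.dim i)) (Fin (S.dim i)) ℝ :=
  message (S.jointR s(k, i)) (S.jointC s(k, i) i) (S.jointC s(k, i) k) M

variable {S}

lemma edgeInfo_posSemidef {e : Sym2 V} (he : e ∈ S.graph.edgeSet) (i : V) :
    (S.edgeInfo e i).PosSemidef :=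
  (S.jointR_posDef e he).inv.posSemidef.transpose_mul_mul_same _

lemma edgeMsg_posSemidef {k i : V} (h : S.graph.Adj k i)
    {M : Matrix (Fin (S.dim k)) (Fin (S.dim k)) ℝ} (hM : M.PosDef) : (S.edgeMsg k i M).PosSemidef :=
  message_posSemidef (S.jointR_posDef _ h) hM

lemma edgeMsg_quad_le_edgeInfo_quad {k i : V} (h : S.graph.Adj k i)
    {M : Matrix (Fin (S.dim k)) (Fin (S.dim k)) ℝ} (hM : M.PosDef) (x : Fin (S.dim i) → ℝ) :
    (S.edgeMsg k i M).quad x ≤ (S.edgeInfo s(k, i) i).quad x :=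
  message_quad_le_of_known (S.jointR_posDef _ h) hM x

/-! ### Bounds by the system constants -/

section bounds

variable [Fintype V]

lemma iSup_norm_edgeInfo_nonneg :
    0 ≤ ⨆ d : S.graph.Dart,
      ‖(S.jointC d.edge d.fst)ᵀ * (S.jointR d.edge)⁻¹ * S.jointC d.edge d.fst‖ :=
  Real.iSup_nonneg fun _ => norm_nonneg _

lemma norm_edgeInfo_le [DecidableEq V] {e : Sym2 V} (he : e ∈ S.graph.edgeSet) {i : V}
    (hi : i ∈ e) :
    ‖S.edgeInfo e i‖ ≤ ⨆ d : S.graph.Dart,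
      ‖(S.jointC d.edge d.fst)ᵀ * (S.jointR d.edge)⁻¹ * S.jointC d.edge d.fst‖ := by
  obtain ⟨k, rfl⟩ := hi
  exact le_ciSup (f := fun d : S.graph.Dart =>
    ‖(S.jointC d.edge d.fst)ᵀ * (S.jointR d.edge)⁻¹ * S.jointC d.edge d.fst‖)
    (Set.finite_range _).bddAbove ⟨(i, k), he⟩

lemma alpha₂_nonneg : 0 ≤ S.alpha₂ := Real.iSup_nonneg fun _ => norm_nonneg _

lemma norm_mul_localInfo_inv_mul_le [DecidableEq V] {e : Sym2 V} (he : e ∈ S.graph.edgeSet) {i : V}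
    (hi : i ∈ e) : ‖S.jointC e i * (S.localInfo i)⁻¹ * (S.jointC e i)ᵀ‖ ≤ S.alpha₂ := by
  obtain ⟨k, rfl⟩ := hi
  exact le_ciSup (f := fun d : S.graph.Dart =>
    ‖S.jointC d.edge d.fst * (S.localInfo d.fst)⁻¹ * (S.jointC d.edge d.fst)ᵀ‖)
    (Set.finite_range _).bddAbove ⟨(i, k), he⟩

lemma beta₁_pos [Nonempty V] (hP : ∀ i, (S.localInfo i).PosDef) : 0 < S.beta₁ := by
  obtain ⟨i, hi⟩ := exists_eq_ciInf_of_finite (f := fun i : V => sigmaMin (S.localInfo i))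
  rw [beta₁, ← hi]
  exact sigmaMin_pos (S.dim_pos i) (hP i)

lemma beta₁_mul_le (hP : ∀ i, (S.localInfo i).PosDef) (i : V) (x : Fin (S.dim i) → ℝ) :
    S.beta₁ * (x ⬝ᵥ x) ≤ (S.localInfo i).quad x := by
  refine le_trans ?_ (sigmaMin_mul_le_quad (hP i) x)
  have h : S.beta₁ ≤ sigmaMin (S.localInfo i) := ciInf_le (Set.finite_range _).bddBelow i
  have : 0 ≤ x ⬝ᵥ x := by simpa using dotProduct_star_self_nonneg x
  gcongr

/-- An edge is needed: over an empty edge set the infimum takes the default value `0`. -/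
lemma beta₂_pos {e : Sym2 V} (he : e ∈ S.graph.edgeSet) : 0 < S.beta₂ := by
  have : Nonempty S.graph.edgeSet := ⟨⟨e, he⟩⟩
  obtain ⟨e', h⟩ := exists_eq_ciInf_of_finite (f := fun e : S.graph.edgeSet => sigmaMin (S.jointR e.1))
  rw [beta₂, ← h]
  exact sigmaMin_pos (S.jointDim_pos _ e'.2) (S.jointR_posDef _ e'.2)

lemma beta₂_nonneg : 0 ≤ S.beta₂ := by
  rcases isEmpty_or_nonempty S.graph.edgeSet with h | ⟨⟨e, he⟩⟩
  · rw [beta₂, Real.iInf_of_isEmpty]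
  · exact (beta₂_pos he).le

lemma beta₂_mul_le {e : Sym2 V} (he : e ∈ S.graph.edgeSet) (x : Fin (S.jointDim e) → ℝ) :
    S.beta₂ * (x ⬝ᵥ x) ≤ (S.jointR e).quad x := by
  refine le_trans ?_ (sigmaMin_mul_le_quad (S.jointR_posDef e he) x)
  have h : S.beta₂ ≤ sigmaMin (S.jointR e) :=
    ciInf_le (f := fun e : S.graph.edgeSet => sigmaMin (S.jointR e.1))
      (Set.finite_range _).bddBelow ⟨e, he⟩
  have : 0 ≤ x ⬝ᵥ x := by simpa using dotProduct_star_self_nonneg x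
  gcongr

/-- The fraction `s` of `message_quad_le_one_add_mul` is at most `α₂ / (α₂ + β₂)`. -/
lemma edgeMsg_fraction [DecidableEq V] (hP : ∀ i, (S.localInfo i).PosDef) {k i : V}
    (h : S.graph.Adj k i) {M : Matrix (Fin (S.dim k)) (Fin (S.dim k)) ℝ} (hM : M.PosDef)
    (hle : ∀ x, (S.localInfo k).quad x ≤ M.quad x) (u : Fin (S.jointDim s(k, i)) → ℝ) :
    (S.jointC s(k, i) k * M⁻¹ * (S.jointC s(k, i) k)ᵀ).quad u ≤
      S.alpha₂ / (S.alpha₂ + S.beta₂) *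
        (S.jointR s(k, i) + S.jointC s(k, i) k * M⁻¹ * (S.jointC s(k, i) k)ᵀ).quad u := by
  have hβ := beta₂_pos (S := S) (e := s(k, i)) h
  have hα := S.alpha₂_nonneg
  have hu : 0 ≤ u ⬝ᵥ u := by simpa using dotProduct_star_self_nonneg u
  have h₁ : (S.jointC s(k, i) k * M⁻¹ * (S.jointC s(k, i) k)ᵀ).quad u ≤ S.alpha₂ * (u ⬝ᵥ u) := by
    calc _ ≤ (S.jointC s(k, i) k * (S.localInfo k)⁻¹ * (S.jointC s(k, i) k)ᵀ).quad u := by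
          rw [mul_mul_transpose_quad, mul_mul_transpose_quad]
          exact (hP k).inv_quad_le_inv_quad hM hle _
      _ ≤ _ := quad_le_norm_mul _ _
      _ ≤ _ := by gcongr; exact norm_mul_localInfo_inv_mul_le h (Sym2.mem_mk_left k i)
  have h₂ := beta₂_mul_le (S := S) (e := s(k, i)) h u
  rw [add_quad, div_mul_eq_mul_div, le_div_iff₀ (by positivity)]
  -- Cross-multiplied, `β₂ (C M⁻¹ Cᵀ) ≤ β₂ α₂ |u|² ≤ α₂ R`; the term `α₂ (C M⁻¹ Cᵀ)` is common to
  -- both sides.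
  nlinarith [mul_le_mul_of_nonneg_left h₁ hβ.le, mul_le_mul_of_nonneg_left h₂ hα]

end bounds

/-! ### The network around a root -/

variable [Fintype V] [DecidableEq V]

variable (S) in
/-- The neighbours of `j` that are farther from `r` than `j` is. -/
def outer (r j : V) : Finset V :=
  (S.graph.neighborFinset j).filter fun k => S.graph.edist r k = S.graph.edist r j + 1

lemma mem_outer {r j k : V} :
    k ∈ S.outer r j ↔ S.graph.Adj j k ∧ S.graph.edist r k = S.graph.edist r j + 1 := by
  simp [outer]

lemma adj_of_mem_outer {r j k : V} (h : k ∈ S.outer r j) : S.graph.Adj k j :=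
  (mem_outer.1 h).1.symm

variable (S) in
/-- Within distance `l` of `r`, a node has at most one neighbour that is not farther from `r` than
the node itself. -/
def UniqueInner (r : V) (l : ℕ) : Prop :=
  ∀ ⦃j k k' : V⦄, S.graph.edist r j ≤ l → S.graph.Adj j k → S.graph.Adj j k' →
    S.graph.edist r k ≤ S.graph.edist r j → S.graph.edist r k' ≤ S.graph.edist r j → k = k'

lemma IsLoopFreeDepth.uniqueInner {r : V} {l : ℕ} (h : S.IsLoopFreeDepth r l) : S.UniqueInner r l :=
  fun _ _ _ hj hk hk' hkd hkd' =>
    SimpleGraph.eq_of_adj_of_edist_le_of_isAcyclic h.1 hj hk hk' hkd hkd'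

/-- This uses that the depth is maximal: in an acyclic graph `l + 1` would qualify as well. So there
is a cycle, and its vertices have degree at least two. -/
lemma IsLoopFreeDepth.one_le_uBar {r : V} {l : ℕ} (h : S.IsLoopFreeDepth r l) : 1 ≤ S.uBar := by
  have hcyc : ¬S.graph.IsAcyclic := fun hac =>
    absurd (h.2 (show l + 1 ∈ _ from hac.induce _)) (by omega)
  have h₂ : (2 : ℝ) ≤ S.graph.maxDegree := by
    exact_mod_cast SimpleGraph.two_le_maxDegree_of_not_isAcyclic hcyc
  rw [uBar]
  linarith

/-- Inside the tree, the message that `j` sends towards the root excludes its parent `i`, so it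
gathers exactly the messages from its children. -/
lemma UniqueInner.erase_eq_outer {r : V} {l : ℕ} (hu : S.UniqueInner r l) {j i : V} {d : ℕ}
    (hj : S.graph.edist r j = (d + 1 : ℕ)) (hi : S.graph.edist r i = d) (hd : d + 1 ≤ l)
    (h : S.graph.Adj j i) : (S.graph.neighborFinset j).erase i = S.outer r j := by
  ext k
  rw [Finset.mem_erase, SimpleGraph.mem_neighborFinset, mem_outer]
  constructor
  · rintro ⟨hk, hjk⟩
    refine ⟨hjk, le_antisymm (SimpleGraph.edist_le_edist_add_one_of_adj hjk) ?_⟩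
    by_contra hlt
    refine hk (hu (by rw [hj]; exact_mod_cast hd) hjk h ?_ ?_)
    · exact Order.lt_add_one_iff_of_not_isMax (by rw [hj]; simp) |>.1 (not_le.1 hlt)
    · rw [hi, hj]; exact_mod_cast Nat.le_succ d
  · rintro ⟨hjk, hk⟩
    refine ⟨?_, hjk⟩
    rintro rfl
    rw [hi, hj] at hk
    norm_cast at hk
    omega

lemma neighborFinset_eq_outer_self (r : V) : S.graph.neighborFinset r = S.outer r r := by
  ext k
  simp only [SimpleGraph.mem_neighborFinset, mem_outer, SimpleGraph.edist_self, zero_add,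
    SimpleGraph.edist_eq_one_iff_adj, and_self]

/-- The root has no parent, so it may have one child more than the other nodes of the tree. -/
lemma card_outer_self_le (r : V) : ((S.outer r r).card : ℝ) ≤ S.uBar + 1 := by
  rw [← neighborFinset_eq_outer_self, uBar, sub_add_cancel, SimpleGraph.card_neighborFinset_eq_degree]
  exact_mod_cast S.graph.degree_le_maxDegree r

lemma UniqueInner.card_outer_le {r : V} {l : ℕ} (hu : S.UniqueInner r l) {j i : V} {d : ℕ}
    (hj : S.graph.edist r j = (d + 1 : ℕ)) (hi : S.graph.edist r i = d) (hd : d + 1 ≤ l)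
    (h : S.graph.Adj j i) : ((S.outer r j).card : ℝ) ≤ S.uBar := by
  have hmem : i ∈ S.graph.neighborFinset j := by simpa using h
  have h₁ := Finset.card_erase_add_one hmem
  rw [hu.erase_eq_outer hj hi hd h, SimpleGraph.card_neighborFinset_eq_degree] at h₁
  have h₂ := S.graph.degree_le_maxDegree j
  rw [← h₁] at h₂
  rw [uBar, le_sub_iff_add_le]
  exact_mod_cast h₂

lemma edist_of_mem_outer {r j k : V} {d : ℕ} (hj : S.graph.edist r j = d) (hk : k ∈ S.outer r j) :
    S.graph.edist r k = (d + 1 : ℕ) := by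
  rw [(mem_outer.1 hk).2, hj]
  norm_cast

/-! ### Information gathered from a subtree -/

variable (S) in
/-- The information on the state of `j` in the measurements of the subtree of depth `h` below `j`,
away from `r`, when there is the additional information `E` on the states of the leaves. -/
def subtreeInfo (r : V) (E : (j : V) → Matrix (Fin (S.dim j)) (Fin (S.dim j)) ℝ) :
    ℕ → (j : V) → Matrix (Fin (S.dim j)) (Fin (S.dim j)) ℝ
  | 0, j => S.localInfo j + E j
  | h + 1, j => S.localInfo j + ∑ k ∈ S.outer r j, S.edgeMsg k j (subtreeInfo r E h k)

variable (S) in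
/-- The information on the state of `j` in the joint measurements with the nodes farther from `r`,
when the states of these nodes are known. -/
def outerInfo (r j : V) : Matrix (Fin (S.dim j)) (Fin (S.dim j)) ℝ :=
  ∑ k ∈ S.outer r j, S.edgeInfo s(k, j) j

lemma outerInfo_posSemidef (r j : V) : (S.outerInfo r j).PosSemidef :=
  posSemidef_sum _ fun _ hk => edgeInfo_posSemidef (adj_of_mem_outer hk) _

section subtreeInfo

variable {r : V} {E : (j : V) → Matrix (Fin (S.dim j)) (Fin (S.dim j)) ℝ}

lemma subtreeInfo_posDef (hP : ∀ i, (S.localInfo i).PosDef) (hE : ∀ j, (E j).PosSemidef) (h : ℕ)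
    (j : V) : (S.subtreeInfo r E h j).PosDef := by
  induction h generalizing j with
  | zero => exact (hP j).add_posSemidef (hE j)
  | succ h ih =>
    exact (hP j).add_posSemidef (posSemidef_sum _ fun k hk =>
      edgeMsg_posSemidef (adj_of_mem_outer hk) (ih k))

lemma localInfo_quad_le_subtreeInfo_quad (hP : ∀ i, (S.localInfo i).PosDef)
    (hE : ∀ j, (E j).PosSemidef) (h : ℕ) (j : V) (x : Fin (S.dim j) → ℝ) :
    (S.localInfo j).quad x ≤ (S.subtreeInfo r E h j).quad x := by
  cases h with
  | zero =>
    rw [subtreeInfo, add_quad]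
    linarith [(hE j).quad_nonneg x]
  | succ h =>
    rw [subtreeInfo, add_quad, le_add_iff_nonneg_right]
    exact (posSemidef_sum _ fun k hk => edgeMsg_posSemidef (adj_of_mem_outer hk)
      (subtreeInfo_posDef hP hE h k)).quad_nonneg x

end subtreeInfo

section uBar

variable {r : V} {l : ℕ}

lemma alpha₁_nonneg (hu : 0 ≤ S.uBar) : 0 ≤ S.alpha₁ :=
  mul_nonneg hu iSup_norm_edgeInfo_nonneg

/-- The factor `c` absorbs the extra child of the root: `c = 2` there, since `ū + 1 ≤ 2 ū`, and `c =
1` at the other nodes. -/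
lemma outerInfo_quad_le {j : V} {c : ℝ} (hc : ((S.outer r j).card : ℝ) ≤ c * S.uBar)
    (x : Fin (S.dim j) → ℝ) : (S.outerInfo r j).quad x ≤ c * S.alpha₁ * (x ⬝ᵥ x) := by
  have hx : 0 ≤ x ⬝ᵥ x := by simpa using dotProduct_star_self_nonneg x
  set B := ⨆ d : S.graph.Dart,
      ‖(S.jointC d.edge d.fst)ᵀ * (S.jointR d.edge)⁻¹ * S.jointC d.edge d.fst‖ with hB
  have hB0 : 0 ≤ B := iSup_norm_edgeInfo_nonneg
  have h₁ : ∀ k ∈ S.outer r j, (S.edgeInfo s(k, j) j).quad x ≤ B * (x ⬝ᵥ x) := fun k hk =>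
    (quad_le_norm_mul _ _).trans (by
      gcongr
      exact norm_edgeInfo_le (adj_of_mem_outer hk) (Sym2.mem_mk_right k j))
  rw [outerInfo, sum_quad, alpha₁, ← hB]
  calc _ ≤ (S.outer r j).card • (B * (x ⬝ᵥ x)) := Finset.sum_le_card_nsmul _ _ _ h₁
    _ = (S.outer r j).card * (B * (x ⬝ᵥ x)) := by rw [nsmul_eq_mul]
    _ ≤ c * S.uBar * (B * (x ⬝ᵥ x)) := by gcongr
    _ = _ := by ring

lemma lam_nonneg [Nonempty V] (hP : ∀ i, (S.localInfo i).PosDef) (hu : 0 ≤ S.uBar) :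
    0 ≤ S.lam := by
  have := alpha₁_nonneg hu
  have := S.alpha₂_nonneg
  have := beta₁_pos hP
  have := S.beta₂_nonneg
  rw [lam]
  positivity

/-- The influence of the information on the leaves decreases by the factor `λ` with every level of
the tree. -/
lemma UniqueInner.subtreeInfo_outerInfo_quad_le (hP : ∀ i, (S.localInfo i).PosDef)
    (hu : S.UniqueInner r l) (hū : 0 ≤ S.uBar) {c : ℝ} (hc : 1 ≤ c) {h d : ℕ} (hd : d + h ≤ l)
    {j : V} (hj : S.graph.edist r j = d) (hcard : ((S.outer r j).card : ℝ) ≤ c * S.uBar)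
    (x : Fin (S.dim j) → ℝ) :
    (S.subtreeInfo r (S.outerInfo r) h j).quad x ≤
      (1 + c * S.lam ^ h * (S.alpha₁ / S.beta₁)) * (S.subtreeInfo r 0 h j).quad x := by
  have : Nonempty V := ⟨r⟩
  have hα := alpha₁_nonneg hū
  have hβ := beta₁_pos hP
  have hα₂ := S.alpha₂_nonneg
  have hβ₂ := S.beta₂_nonneg
  have hlam := lam_nonneg hP hū
  have hP1 := beta₁_mul_le hP j x
  have hO := outerInfo_quad_le hcard x
  have hcα : 0 ≤ c * S.alpha₁ := by positivity
  induction h generalizing d j c with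
  | zero =>
    simp only [subtreeInfo, Pi.zero_apply, add_zero, pow_zero, mul_one]
    rw [add_quad, add_mul, one_mul, mul_div_assoc', div_mul_eq_mul_div]
    gcongr
    rw [le_div_iff₀ hβ]
    nlinarith [mul_le_mul_of_nonneg_left hP1 hcα]
  | succ h ih =>
    -- The relative gap at the children, which have a parent and therefore satisfy the induction
    -- hypothesis with `c = 1`.
    set ε := S.lam ^ h * (S.alpha₁ / S.beta₁) with hε
    have hε0 : 0 ≤ ε := by positivity
    set s := S.alpha₂ / (S.alpha₂ + S.beta₂) with hs
    have hs0 : 0 ≤ s := by positivity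
    have h0 : ∀ j, ((0 : (j : V) → Matrix (Fin (S.dim j)) (Fin (S.dim j)) ℝ) j).PosSemidef :=
      fun _ => PosSemidef.zero
    have hlo := subtreeInfo_posDef (r := r) hP h0 h
    have hhi := subtreeInfo_posDef (r := r) hP (S.outerInfo_posSemidef r) h
    have hstep : ∀ k ∈ S.outer r j,
        (S.edgeMsg k j (S.subtreeInfo r (S.outerInfo r) h k)).quad x ≤
          (1 + s * ε) * (S.edgeMsg k j (S.subtreeInfo r 0 h k)).quad x := by
      intro k hk
      have hkd := edist_of_mem_outer hj hk
      have hkc := hu.card_outer_le hkd hj (by omega) (adj_of_mem_outer hk)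
      refine message_quad_le_one_add_mul (S.jointR_posDef _ (adj_of_mem_outer hk)) (hlo k) (hhi k)
        hε0 (fun z => ?_) ?_ x
      · have := ih (c := 1) le_rfl (d := d + 1) (by omega) hkd (by rwa [one_mul]) z
          (beta₁_mul_le hP k z) (outerInfo_quad_le (by rwa [one_mul]) z) (by simpa using hα)
        rwa [one_mul] at this
      · exact edgeMsg_fraction hP (adj_of_mem_outer hk) (hlo k)
          (localInfo_quad_le_subtreeInfo_quad hP h0 h k)
    set X := ∑ k ∈ S.outer r j, (S.edgeMsg k j (S.subtreeInfo r 0 h k)).quad x with hX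
    have hX0 : 0 ≤ X := Finset.sum_nonneg fun k hk =>
      (edgeMsg_posSemidef (adj_of_mem_outer hk) (hlo k)).quad_nonneg x
    have hXle : X ≤ c * S.alpha₁ * (x ⬝ᵥ x) := by
      refine le_trans ?_ hO
      rw [outerInfo, sum_quad]
      exact Finset.sum_le_sum fun k hk =>
        edgeMsg_quad_le_edgeInfo_quad (adj_of_mem_outer hk) (hlo k) x
    -- The messages make up at most this share of the information at `j`: `β₁ X ≤ c α₁ P_j`, and `α₁
    -- X ≤ c α₁ X` because `1 ≤ c`.
    have hfrac : X ≤ c * (S.alpha₁ / (S.alpha₁ + S.beta₁)) * ((S.localInfo j).quad x + X) := by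
      rw [mul_div_assoc', div_mul_eq_mul_div, le_div_iff₀ (by positivity)]
      nlinarith [mul_le_mul_of_nonneg_left hXle hβ.le, mul_le_mul_of_nonneg_left hP1 hcα,
        mul_nonneg (mul_nonneg (sub_nonneg.2 hc) hα) hX0]
    simp only [subtreeInfo]
    rw [add_quad, add_quad, sum_quad, sum_quad, ← hX]
    calc _ ≤ (S.localInfo j).quad x + (1 + s * ε) * X := by
          rw [hX, Finset.mul_sum]
          gcongr with k hk
          exact hstep k hk
      _ = (S.localInfo j).quad x + X + s * ε * X := by ring
      _ ≤ (S.localInfo j).quad x + X +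
          s * ε * (c * (S.alpha₁ / (S.alpha₁ + S.beta₁)) * ((S.localInfo j).quad x + X)) := by
          gcongr
      _ = _ := by rw [pow_succ, hε, hs, lam]; ring

end uBar

/-! ### The algorithm between two subtree recursions -/

section algorithm

variable {r : V} {l : ℕ}

/-- Subtracting the message from `i` amounts to leaving it out of the sum. In this form positivity
is evident. -/
lemma msg_succ_eq_edgeMsg {k i : V} (h : S.graph.Adj k i) (N : ℕ) :
    S.msg (N + 1) k i = S.edgeMsg k i
      (S.localInfo k + ∑ m ∈ (S.graph.neighborFinset k).erase i, S.msg N m k) := by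
  have hmem : i ∈ S.graph.neighborFinset k := by simpa using h
  have : S.localInfo k + ∑ m ∈ (S.graph.neighborFinset k).erase i, S.msg N m k =
      (S.localInfo k + ∑ m ∈ S.graph.neighborFinset k, S.msg N m k) - S.msg N i k := by
    rw [← Finset.sum_erase_add _ _ hmem]
    abel
  rw [this]
  rfl

lemma msg_posSemidef (hP : ∀ i, (S.localInfo i).PosDef) (N : ℕ) {k i : V} (h : S.graph.Adj k i) :
    (S.msg N k i).PosSemidef := by
  induction N generalizing k i with
  | zero => exact PosSemidef.zero
  | succ N ih =>
    rw [msg_succ_eq_edgeMsg h]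
    refine edgeMsg_posSemidef h ((hP k).add_posSemidef (posSemidef_sum _ fun m hm => ih ?_))
    simpa using (Finset.mem_of_mem_erase hm : m ∈ S.graph.neighborFinset k) |>
      (S.graph.mem_neighborFinset k m).1 |>.symm

lemma localInfo_add_sum_msg_posDef (hP : ∀ i, (S.localInfo i).PosDef) (N : ℕ) (k : V) {s : Finset V}
    (hs : s ⊆ S.graph.neighborFinset k) : (S.localInfo k + ∑ m ∈ s, S.msg N m k).PosDef :=
  (hP k).add_posSemidef (posSemidef_sum _ fun m hm =>
    msg_posSemidef hP N ((S.graph.mem_neighborFinset k m).1 (hs hm)).symm)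

lemma msg_quad_le_edgeInfo_quad (hP : ∀ i, (S.localInfo i).PosDef) (N : ℕ) {k i : V}
    (h : S.graph.Adj k i) (x : Fin (S.dim i) → ℝ) :
    (S.msg N k i).quad x ≤ (S.edgeInfo s(k, i) i).quad x := by
  cases N with
  | zero => simpa [msg] using (edgeInfo_posSemidef (S := S) (e := s(k, i)) h i).quad_nonneg x
  | succ N =>
    rw [msg_succ_eq_edgeMsg h]
    exact edgeMsg_quad_le_edgeInfo_quad h
      (localInfo_add_sum_msg_posDef hP N k (Finset.erase_subset _ _)) x

/-- At the leaves, any incoming message lies between zero and the full edge information;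
monotonicity carries both bounds towards the root. Each level uses up one iteration, hence `h ≤ N`.
-/
lemma UniqueInner.subtreeInfo_quad_le (hP : ∀ i, (S.localInfo i).PosDef) (hu : S.UniqueInner r l)
    {h d N : ℕ} (hd : d + h ≤ l) (hN : h ≤ N) {j : V} (hj : S.graph.edist r j = d)
    (x : Fin (S.dim j) → ℝ) :
    (S.subtreeInfo r 0 h j).quad x ≤ (S.localInfo j + ∑ k ∈ S.outer r j, S.msg N k j).quad x ∧
    (S.localInfo j + ∑ k ∈ S.outer r j, S.msg N k j).quad x ≤
      (S.subtreeInfo r (S.outerInfo r) h j).quad x := by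
  induction h generalizing d j N with
  | zero =>
    simp only [subtreeInfo, Pi.zero_apply, add_zero]
    rw [add_quad, add_quad, sum_quad, outerInfo, sum_quad]
    constructor
    · rw [le_add_iff_nonneg_right]
      exact Finset.sum_nonneg fun k hk => (msg_posSemidef hP N (adj_of_mem_outer hk)).quad_nonneg x
    · gcongr with k hk
      exact msg_quad_le_edgeInfo_quad hP N (adj_of_mem_outer hk) x
  | succ h ih =>
    obtain ⟨N, rfl⟩ : ∃ N', N = N' + 1 := ⟨N - 1, by omega⟩
    simp only [subtreeInfo]
    rw [add_quad, add_quad, add_quad, sum_quad, sum_quad, sum_quad]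
    have hmsg : ∀ k ∈ S.outer r j, S.msg (N + 1) k j =
        S.edgeMsg k j (S.localInfo k + ∑ m ∈ S.outer r k, S.msg N m k) := by
      intro k hk
      rw [msg_succ_eq_edgeMsg (adj_of_mem_outer hk), hu.erase_eq_outer (edist_of_mem_outer hj hk) hj
        (by omega) (adj_of_mem_outer hk)]
    have hpos (k : V) := localInfo_add_sum_msg_posDef hP N k
      (Finset.filter_subset _ _ : S.outer r k ⊆ _)
    have hih (k : V) (hk : k ∈ S.outer r j) :=
      ih (d := d + 1) (by omega) (by omega : h ≤ N) (edist_of_mem_outer hj hk)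
    constructor <;> gcongr with k hk <;> rw [hmsg k hk]
    · exact message_quad_mono (S.jointR_posDef _ (adj_of_mem_outer hk))
        (subtreeInfo_posDef hP (fun _ => PosSemidef.zero) h k) (hpos k)
        (fun z => (hih k hk z).1) x
    · exact message_quad_mono (S.jointR_posDef _ (adj_of_mem_outer hk)) (hpos k)
        (subtreeInfo_posDef hP (S.outerInfo_posSemidef r) h k)
        (fun z => (hih k hk z).2) x

lemma infoMatrix_posDef (hP : ∀ i, (S.localInfo i).PosDef) (i : V) (N : ℕ) :
    (S.infoMatrix i N).PosDef :=
  localInfo_add_sum_msg_posDef hP _ i subset_rfl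

lemma UniqueInner.subtreeInfo_quad_le_infoMatrix_quad (hP : ∀ i, (S.localInfo i).PosDef)
    (hu : S.UniqueInner r l) {N : ℕ} (hN : l + 1 ≤ N) (x : Fin (S.dim r) → ℝ) :
    (S.subtreeInfo r 0 l r).quad x ≤ (S.infoMatrix r N).quad x ∧
    (S.infoMatrix r N).quad x ≤ (S.subtreeInfo r (S.outerInfo r) l r).quad x := by
  rw [infoMatrix, neighborFinset_eq_outer_self]
  -- `infoMatrix r N` uses the messages of iteration `N - 1`, which is at least `l`.
  exact hu.subtreeInfo_quad_le hP (d := 0) (by omega) (by omega) (by simp) x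

end algorithm

end SensorNetwork

/-! ### Block-diagonal positive definite matrices. -/

namespace Matrix

lemma fromBlocks_quad {m n : Type*} [Fintype m] [Fintype n] (A : Matrix m m ℝ) (D : Matrix n n ℝ)
    (x : m ⊕ n → ℝ) :
    (fromBlocks A 0 0 D).quad x = A.quad (x ∘ Sum.inl) + D.quad (x ∘ Sum.inr) := by
  simp [quad, fromBlocks_mulVec, dotProduct, Fintype.sum_sum_type]

lemma blockDiagonal'_quad {ι : Type*} [Fintype ι] [DecidableEq ι] {n : ι → Type*}
    [∀ i, Fintype (n i)] (A : (i : ι) → Matrix (n i) (n i) ℝ) (x : (i : ι) × n i → ℝ) :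
    (blockDiagonal' A).quad x = ∑ i, (A i).quad fun a => x ⟨i, a⟩ := by
  simp only [quad, dotProduct, mulVec, Fintype.sum_sigma]
  refine Finset.sum_congr rfl fun i _ => Finset.sum_congr rfl fun a _ => ?_
  congr 1
  rw [Finset.sum_eq_single i]
  · simp [blockDiagonal'_apply]
  · intro j _ hj
    simp [blockDiagonal'_apply, hj.symm]
  · simp

lemma posDef_of_quad_pos {n : Type*} [Fintype n] {A : Matrix n n ℝ} (hA : A.IsHermitian)
    (h : ∀ x, x ≠ 0 → 0 < A.quad x) : A.PosDef :=
  .of_dotProduct_mulVec_pos hA fun x hx => h x hx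

lemma PosDef.blockDiagonal' {ι : Type*} [Fintype ι] [DecidableEq ι] {n : ι → Type*}
    [∀ i, Fintype (n i)] {A : (i : ι) → Matrix (n i) (n i) ℝ} (hA : ∀ i, (A i).PosDef) :
    (blockDiagonal' A).PosDef := by
  refine posDef_of_quad_pos ?_ fun x hx => ?_
  · rw [IsHermitian, blockDiagonal'_conjTranspose]
    exact congrArg _ (funext fun i => (hA i).isHermitian.eq)
  · rw [blockDiagonal'_quad]
    obtain ⟨⟨i, a⟩, hia⟩ := Function.ne_iff.1 hx
    exact Finset.sum_pos' (fun i _ => (hA i).quad_nonneg _) ⟨i, Finset.mem_univ i,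
      (hA i).dotProduct_mulVec_pos (x := fun a => x ⟨i, a⟩) fun h => hia (congrFun h a)⟩

lemma PosDef.fromBlocks_zero {m n : Type*} [Fintype m] [Fintype n] {A : Matrix m m ℝ}
    {D : Matrix n n ℝ} (hA : A.PosDef) (hD : D.PosDef) : (fromBlocks A 0 0 D).PosDef := by
  refine posDef_of_quad_pos ?_ fun x hx => ?_
  · rw [IsHermitian, fromBlocks_conjTranspose, hA.isHermitian.eq, hD.isHermitian.eq]
    simp
  · rw [fromBlocks_quad]
    by_cases h : x ∘ Sum.inl = 0
    · have h' : x ∘ Sum.inr ≠ 0 := fun h' => hx (funext fun a => by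
        cases a with
        | inl a => exact congrFun h a
        | inr a => exact congrFun h' a)
      exact add_pos_of_nonneg_of_pos (hA.quad_nonneg _) (hD.dotProduct_mulVec_pos h')
    · exact add_pos_of_pos_of_nonneg (hA.dotProduct_mulVec_pos h) (hD.quad_nonneg _)

lemma PosDef.inv_mul_cancel {n : Type*} [Fintype n] [DecidableEq n] {A : Matrix n n ℝ}
    (hA : A.PosDef) : A⁻¹ * A = 1 :=
  nonsing_inv_mul _ ((isUnit_iff_isUnit_det _).1 hA.isUnit)

lemma PosDef.mul_inv_cancel {n : Type*} [Fintype n] [DecidableEq n] {A : Matrix n n ℝ}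
    (hA : A.PosDef) : A * A⁻¹ = 1 :=
  mul_nonsing_inv _ ((isUnit_iff_isUnit_det _).1 hA.isUnit)

lemma blockDiagonal'_inv_of_posDef {ι : Type*} [Fintype ι] [DecidableEq ι] {n : ι → Type*}
    [∀ i, Fintype (n i)] [∀ i, DecidableEq (n i)] {A : (i : ι) → Matrix (n i) (n i) ℝ}
    (hA : ∀ i, (A i).PosDef) :
    (Matrix.blockDiagonal' A)⁻¹ = Matrix.blockDiagonal' fun i => (A i)⁻¹ := by
  refine inv_eq_right_inv ?_
  rw [← blockDiagonal'_mul, ← blockDiagonal'_one]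
  exact congrArg _ (funext fun i => (hA i).mul_inv_cancel)

lemma PosDef.fromBlocks_zero_inv {m n : Type*} [Fintype m] [Fintype n] [DecidableEq m]
    [DecidableEq n] {A : Matrix m m ℝ} {D : Matrix n n ℝ} (hA : A.PosDef) (hD : D.PosDef) :
    (fromBlocks A 0 0 D)⁻¹ = fromBlocks A⁻¹ 0 0 D⁻¹ := by
  refine inv_eq_right_inv ?_
  simp [fromBlocks_multiply, hA.mul_inv_cancel, hD.mul_inv_cancel]

end Matrix

namespace SensorNetwork

variable {V : Type*} [Fintype V] [DecidableEq V] {S : SensorNetwork V}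

/-! ### The weighted least squares problem -/

variable (S) in
/-- The information matrix of the centralized weighted least squares problem. -/
def globalInfo : Matrix S.Param S.Param ℝ := S.globalCᵀ * S.globalR⁻¹ * S.globalC

variable (S) in
/-- The noise-free joint measurement of the edge `e` at the states `y`. -/
def jointValue (e : Sym2 V) (y : (i : V) → Fin (S.dim i) → ℝ) : Fin (S.jointDim e) → ℝ :=
  ∑ i with i ∈ e, S.jointC e i *ᵥ y i

lemma jointValue_mk {k j : V} (h : S.graph.Adj k j) (y : (i : V) → Fin (S.dim i) → ℝ) :
    S.jointValue s(k, j) y = S.jointC s(k, j) j *ᵥ y j + S.jointC s(k, j) k *ᵥ y k := by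
  have : (Finset.univ.filter fun i => i ∈ s(k, j)) = {j, k} := by
    ext i
    simp [or_comm]
  rw [jointValue, this, Finset.sum_pair h.ne.symm]

variable (S) in
/-- The cost of the states `y` in the weighted least squares problem with zero measurements. -/
def energy (y : (i : V) → Fin (S.dim i) → ℝ) : ℝ :=
  ∑ i, (S.localInfo i).quad (y i) +
    ∑ e : S.graph.edgeSet, (S.jointR e.1)⁻¹.quad (S.jointValue e.1 y)

lemma globalR_posDef : S.globalR.PosDef :=
  (PosDef.blockDiagonal' S.selfR_posDef).fromBlocks_zero
    (PosDef.blockDiagonal' fun e => S.jointR_posDef e.1 e.2)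

lemma globalC_mulVec_inl (y : (i : V) → Fin (S.dim i) → ℝ) (i : V) :
    (fun a => (S.globalC *ᵥ fun p => y p.1 p.2) (Sum.inl ⟨i, a⟩)) = S.selfC i *ᵥ y i := by
  ext a
  rw [globalC, fromRows_mulVec, Sum.elim_inl]
  simp only [mulVec, dotProduct, Fintype.sum_sigma]
  rw [Finset.sum_eq_single i]
  · simp [blockDiagonal'_apply]
  · intro j _ hj
    simp [blockDiagonal'_apply, hj.symm]
  · simp

lemma globalC_mulVec_inr (y : (i : V) → Fin (S.dim i) → ℝ) (e : S.graph.edgeSet) :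
    (fun a => (S.globalC *ᵥ fun p => y p.1 p.2) (Sum.inr ⟨e, a⟩)) = S.jointValue e.1 y := by
  ext a
  rw [globalC, fromRows_mulVec, Sum.elim_inr, jointValue, Finset.sum_apply, Finset.sum_filter]
  simp only [mulVec, dotProduct, Fintype.sum_sigma, globalJointC, of_apply]
  refine Finset.sum_congr rfl fun i _ => ?_
  split_ifs <;> simp

/-- The noise covariance is block diagonal, so the global cost splits into one term per measurement.
-/
lemma globalInfo_quad (y : (i : V) → Fin (S.dim i) → ℝ) :
    S.globalInfo.quad (fun p => y p.1 p.2) = S.energy y := by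
  rw [globalInfo, transpose_mul_mul_quad, globalR, PosDef.fromBlocks_zero_inv
    (PosDef.blockDiagonal' S.selfR_posDef) (PosDef.blockDiagonal' fun e => S.jointR_posDef e.1 e.2),
    blockDiagonal'_inv_of_posDef S.selfR_posDef,
    blockDiagonal'_inv_of_posDef fun e : S.graph.edgeSet => S.jointR_posDef e.1 e.2,
    fromBlocks_quad, blockDiagonal'_quad, blockDiagonal'_quad, energy]
  simp only [Function.comp_apply, globalC_mulVec_inl, globalC_mulVec_inr, localInfo,
    transpose_mul_mul_quad]

lemma globalInfo_isHermitian : S.globalInfo.IsHermitian :=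
  (globalR_posDef.inv.posSemidef.transpose_mul_mul_same S.globalC).isHermitian

lemma globalInfo_posDef (hP : ∀ i, (S.localInfo i).PosDef) : S.globalInfo.PosDef := by
  refine posDef_of_quad_pos globalInfo_isHermitian fun x hx => ?_
  obtain ⟨⟨i, a⟩, hia⟩ := Function.ne_iff.1 hx
  refine lt_of_lt_of_eq ?_ (globalInfo_quad fun i a => x ⟨i, a⟩).symm
  rw [energy]
  refine add_pos_of_pos_of_nonneg (Finset.sum_pos' (fun i _ => (hP i).quad_nonneg _)
    ⟨i, Finset.mem_univ i, (hP i).dotProduct_mulVec_pos fun h => hia (congrFun h a)⟩)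
    (Finset.sum_nonneg fun e _ => (S.jointR_posDef e.1 e.2).inv.quad_nonneg _)

/-- The gain is a left inverse of `globalC`, so the true state cancels and the error is linear in
the noise. -/
lemma wlsEstimate_measurement_sub (hP : ∀ i, (S.localInfo i).PosDef) {Ω : Type*}
    (x : S.Param → ℝ) (v : S.Row → Ω → ℝ) (ω : Ω) (p : S.Param) :
    S.wlsEstimate (S.measurement x v ω) p - x p =
      ∑ a, (S.globalInfo⁻¹ * (S.globalCᵀ * S.globalR⁻¹)) p a * v a ω := by
  have h : S.wlsEstimate (S.measurement x v ω) =
      x + (S.globalInfo⁻¹ * (S.globalCᵀ * S.globalR⁻¹)) *ᵥ fun a => v a ω := by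
    have hG : S.globalCᵀ * S.globalR⁻¹ * S.globalC = S.globalInfo := rfl
    rw [wlsEstimate, measurement, hG, mulVec_mulVec, mulVec_mulVec, mulVec_add, mulVec_mulVec,
      Matrix.mul_assoc, Matrix.mul_assoc, ← Matrix.mul_assoc S.globalCᵀ, hG,
      (globalInfo_posDef hP).inv_mul_cancel, one_mulVec, Matrix.mul_assoc]
  rw [h, Pi.add_apply, add_sub_cancel_left]
  rfl

/-- The error covariance is `H R Hᵀ` with gain `H = G⁻¹ Cᵀ R⁻¹`, and this collapses to `G⁻¹`. -/
lemma wlsCov_eq (hP : ∀ i, (S.localInfo i).PosDef) {Ω : Type*} [MeasurableSpace Ω]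
    {P : Measure Ω} [IsProbabilityMeasure P] {v : S.Row → Ω → ℝ} (hv : S.IsNoise P v)
    (x : S.Param → ℝ) (i : V) :
    S.wlsCov P x v i = S.globalInfo⁻¹.submatrix (Sigma.mk i) (Sigma.mk i) := by
  have hGi : (S.globalInfo⁻¹)ᵀ = S.globalInfo⁻¹ := by
    simpa using (globalInfo_posDef hP).inv.isHermitian.eq
  have hRi : (S.globalR⁻¹)ᵀ = S.globalR⁻¹ := by
    simpa using (globalR_posDef (S := S)).inv.isHermitian.eq
  set H := S.globalInfo⁻¹ * (S.globalCᵀ * S.globalR⁻¹) with hH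
  have hHR : H * S.globalR * Hᵀ = S.globalInfo⁻¹ := by
    rw [hH, transpose_mul, transpose_mul, transpose_transpose, hGi, hRi]
    calc _ = S.globalInfo⁻¹ * (S.globalCᵀ * (S.globalR⁻¹ * S.globalR) * S.globalR⁻¹ * S.globalC) *
          S.globalInfo⁻¹ := by simp only [Matrix.mul_assoc]
      _ = S.globalInfo⁻¹ * S.globalInfo * S.globalInfo⁻¹ := by
          rw [globalR_posDef.inv_mul_cancel, Matrix.mul_one, globalInfo]
      _ = _ := by rw [(globalInfo_posDef hP).inv_mul_cancel, Matrix.one_mul]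
  have hcov (p q : S.Param) : cov[fun ω => ∑ a, H p a * v a ω, fun ω => ∑ a, H q a * v a ω; P] =
      S.globalInfo⁻¹ p q := by
    rw [covariance_fun_sum_fun_sum (fun a => (hv.memLp a).const_mul _)
      (fun a => (hv.memLp a).const_mul _), ← hHR]
    simp only [covariance_const_mul_left, covariance_const_mul_right, hv.cov_eq, mul_apply,
      transpose_apply, Finset.sum_mul]
    rw [Finset.sum_comm]
    refine Finset.sum_congr rfl fun a _ => Finset.sum_congr rfl fun b _ => ?_
    ring
  ext a b
  rw [wlsCov, of_apply, submatrix_apply, ← hcov]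
  simp only [wlsEstimate_measurement_sub hP, hH]

/-! ### Elimination of the nodes far from the root -/

variable {r : V} {l : ℕ}

variable (S) in
/-- The nodes at distance `d` from `r`. -/
def level (r : V) (d : ℕ) : Finset V := Finset.univ.filter fun j => S.graph.edist r j = d

variable (S) in
/-- The nodes at distance less than `d` from `r`. -/
def inside (r : V) (d : ℕ) : Finset V := Finset.univ.filter fun j => S.graph.edist r j < d

variable (S) in
/-- The cost of the self measurement of `j` and of its joint measurements with the nodes farther
from `r`. -/
def nodeEnergy (r : V) (y : (i : V) → Fin (S.dim i) → ℝ) (j : V) : ℝ :=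
  (S.localInfo j).quad (y j) +
    ∑ k ∈ S.outer r j, (S.jointR s(k, j))⁻¹.quad (S.jointValue s(k, j) y)

lemma mem_level {d : ℕ} {j : V} : j ∈ S.level r d ↔ S.graph.edist r j = d := by simp [level]

lemma mem_inside {d : ℕ} {j : V} : j ∈ S.inside r d ↔ S.graph.edist r j < d := by simp [inside]

lemma level_zero : S.level r 0 = {r} := by
  ext j
  rw [mem_level, Finset.mem_singleton, Nat.cast_zero, SimpleGraph.edist_eq_zero_iff, eq_comm]

lemma inside_zero : S.inside r 0 = ∅ := by
  ext j
  simp [mem_inside]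

lemma sum_inside_succ (d : ℕ) (f : V → ℝ) :
    ∑ j ∈ S.inside r (d + 1), f j = ∑ j ∈ S.inside r d, f j + ∑ j ∈ S.level r d, f j := by
  have hd : Disjoint (S.inside r d) (S.level r d) :=
    Finset.disjoint_left.2 fun j h₁ h₂ => (mem_inside.1 h₁).ne (mem_level.1 h₂)
  rw [← Finset.sum_union hd]
  congr 1
  ext j
  rw [Finset.mem_union, mem_inside, mem_inside, mem_level, ← le_iff_lt_or_eq]
  push_cast
  exact Order.lt_add_one_iff_of_not_isMax (by simp)

/-- Every node of level `d + 1` has a parent, and only one, so the sets of children partition the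
level. -/
lemma UniqueInner.sum_level_succ (hu : S.UniqueInner r l) {d : ℕ} (hd : d + 1 ≤ l) (f : V → ℝ) :
    ∑ k ∈ S.level r (d + 1), f k = ∑ j ∈ S.level r d, ∑ k ∈ S.outer r j, f k := by
  rw [← Finset.sum_biUnion]
  · congr 1
    ext k
    rw [Finset.mem_biUnion, mem_level]
    constructor
    · intro hk
      obtain ⟨j, hadj, hj⟩ := SimpleGraph.exists_adj_edist_eq hk
      refine ⟨j, mem_level.2 hj, mem_outer.2 ⟨hadj.symm, ?_⟩⟩
      rw [hk, hj]
      push_cast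
      rfl
    · rintro ⟨j, hj, hk⟩
      exact edist_of_mem_outer (mem_level.1 hj) hk
  · intro j hj j' hj' hne
    refine Finset.disjoint_left.2 fun k hk hk' => hne ?_
    have hkd := edist_of_mem_outer (mem_level.1 hj) hk
    refine hu (j := k) (by rw [hkd]; exact_mod_cast hd) (adj_of_mem_outer hk) (adj_of_mem_outer hk')
      ?_ ?_
    · rw [hkd, mem_level.1 hj]; exact_mod_cast Nat.le_succ d
    · rw [hkd, mem_level.1 hj']; exact_mod_cast Nat.le_succ d

section eliminate

variable {E : (j : V) → Matrix (Fin (S.dim j)) (Fin (S.dim j)) ℝ}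

variable (S) in
/-- The optimal cost of the measurements around `r`, as a function of the states of the nodes at
distance at most `d` from `r`. -/
def partialEnergy (r : V) (E : (j : V) → Matrix (Fin (S.dim j)) (Fin (S.dim j)) ℝ) (h d : ℕ)
    (y : (i : V) → Fin (S.dim i) → ℝ) : ℝ :=
  ∑ j ∈ S.inside r d, S.nodeEnergy r y j + ∑ j ∈ S.level r d, (S.subtreeInfo r E h j).quad (y j)

lemma partialEnergy_zero (h : ℕ) (y : (i : V) → Fin (S.dim i) → ℝ) :
    S.partialEnergy r E h 0 y = (S.subtreeInfo r E h r).quad (y r) := by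
  simp [partialEnergy, inside_zero, level_zero]

/-- Each summand is the gap between the cost of a child with its edge and the minimum of that cost
over the state of the child. -/
lemma UniqueInner.partialEnergy_succ (hu : S.UniqueInner r l) {h d : ℕ} (hd : d + 1 ≤ l)
    (y : (i : V) → Fin (S.dim i) → ℝ) :
    S.partialEnergy r E h (d + 1) y - S.partialEnergy r E (h + 1) d y =
      ∑ j ∈ S.level r d, ∑ k ∈ S.outer r j,
        ((S.subtreeInfo r E h k).quad (y k) + (S.jointR s(k, j))⁻¹.quad
          (S.jointC s(k, j) j *ᵥ y j + S.jointC s(k, j) k *ᵥ y k) -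
            (S.edgeMsg k j (S.subtreeInfo r E h k)).quad (y j)) := by
  rw [partialEnergy, partialEnergy, sum_inside_succ, hu.sum_level_succ hd, add_assoc,
    add_sub_add_left_eq_sub, ← Finset.sum_add_distrib, ← Finset.sum_sub_distrib]
  refine Finset.sum_congr rfl fun j _ => ?_
  rw [nodeEnergy, subtreeInfo, add_quad, sum_quad, Finset.sum_sub_distrib, Finset.sum_add_distrib]
  have : ∀ k ∈ S.outer r j, (S.jointR s(k, j))⁻¹.quad (S.jointValue s(k, j) y) =
      (S.jointR s(k, j))⁻¹.quad (S.jointC s(k, j) j *ᵥ y j + S.jointC s(k, j) k *ᵥ y k) :=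
    fun k hk => by rw [jointValue_mk (adj_of_mem_outer hk)]
  rw [Finset.sum_congr rfl this]
  ring

/-- All elimination gaps are nonnegative, so eliminating the levels one after another only lowers
the cost. -/
lemma UniqueInner.subtreeInfo_quad_le_partialEnergy (hP : ∀ i, (S.localInfo i).PosDef)
    (hE : ∀ j, (E j).PosSemidef) (hu : S.UniqueInner r l) {h d : ℕ} (hd : d + h = l)
    (y : (i : V) → Fin (S.dim i) → ℝ) :
    (S.subtreeInfo r E l r).quad (y r) ≤ S.partialEnergy r E h d y := by
  induction d generalizing h with
  | zero =>
    obtain rfl : h = l := by omega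
    rw [partialEnergy_zero]
  | succ d ih =>
    refine (ih (h := h + 1) (by omega)).trans (sub_nonneg.1 ?_)
    rw [hu.partialEnergy_succ (by omega)]
    refine Finset.sum_nonneg fun j _ => Finset.sum_nonneg fun k hk => sub_nonneg.2 ?_
    exact message_quad_le (S.jointR_posDef _ (adj_of_mem_outer hk)) (subtreeInfo_posDef hP hE h k) _ _

lemma nodeEnergy_congr {y y' : (i : V) → Fin (S.dim i) → ℝ} {j : V} (hj : y j = y' j)
    (h : ∀ k ∈ S.outer r j, y k = y' k) : S.nodeEnergy r y j = S.nodeEnergy r y' j := by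
  rw [nodeEnergy, nodeEnergy, hj]
  congr 1
  refine Finset.sum_congr rfl fun k hk => ?_
  rw [jointValue_mk (adj_of_mem_outer hk), jointValue_mk (adj_of_mem_outer hk), hj, h k hk]

lemma partialEnergy_congr {h d : ℕ} {y y' : (i : V) → Fin (S.dim i) → ℝ}
    (hy : ∀ j, S.graph.edist r j ≤ d → y j = y' j) :
    S.partialEnergy r E h d y = S.partialEnergy r E h d y' := by
  rw [partialEnergy, partialEnergy]
  congr 1
  · refine Finset.sum_congr rfl fun j hj => nodeEnergy_congr (hy j (mem_inside.1 hj).le)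
      fun k hk => hy k ?_
    rw [(mem_outer.1 hk).2]
    exact Order.add_one_le_of_lt (mem_inside.1 hj)
  · exact Finset.sum_congr rfl fun j hj => by rw [hy j (mem_level.1 hj).le]

/-- Back substitution: going outward, each child gets the minimizer determined by its parent, so
every gap vanishes. States beyond level `d` stay zero, as needed for comparison with the full cost.
-/
lemma UniqueInner.exists_partialEnergy_eq (hP : ∀ i, (S.localInfo i).PosDef)
    (hE : ∀ j, (E j).PosSemidef) (hu : S.UniqueInner r l) {h d : ℕ} (hd : d + h = l)
    (x : Fin (S.dim r) → ℝ) :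
    ∃ y : (i : V) → Fin (S.dim i) → ℝ, y r = x ∧ (∀ k, d < S.graph.edist r k → y k = 0) ∧
      S.partialEnergy r E h d y = (S.subtreeInfo r E l r).quad x := by
  induction d generalizing h with
  | zero =>
    obtain rfl : h = l := by omega
    refine ⟨Pi.single r x, by simp, fun k hk => ?_, by simp [partialEnergy_zero]⟩
    rw [Pi.single_eq_of_ne]
    rintro rfl
    simp at hk
  | succ d ih =>
    obtain ⟨y, hyr, hy0, hy⟩ := ih (h := h + 1) (by omega)
    -- The new value at `k` is well defined because `k` has a unique parent.
    have hex (k : V) : ∃ z : Fin (S.dim k) → ℝ,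
        (S.graph.edist r k ≠ (d + 1 : ℕ) → z = y k) ∧
        ∀ j ∈ S.level r d, k ∈ S.outer r j →
          z = messageArg (S.jointR s(k, j)) (S.jointC s(k, j) j) (S.jointC s(k, j) k)
            (S.subtreeInfo r E h k) (y j) := by
      by_cases hk : S.graph.edist r k = (d + 1 : ℕ)
      · obtain ⟨j, hadj, hj⟩ := SimpleGraph.exists_adj_edist_eq hk
        refine ⟨messageArg (S.jointR s(k, j)) (S.jointC s(k, j) j) (S.jointC s(k, j) k)
          (S.subtreeInfo r E h k) (y j), fun h => absurd hk h, fun j' hj' hkj' => ?_⟩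
        have hle : (d : ℕ∞) ≤ (d + 1 : ℕ) := by exact_mod_cast Nat.le_succ d
        have hl : d + 1 ≤ l := by omega
        obtain rfl : j = j' := hu (j := k) (by rw [hk]; exact_mod_cast hl) hadj
          (adj_of_mem_outer hkj') (by rwa [hk, hj]) (by rwa [hk, mem_level.1 hj'])
        rfl
      · exact ⟨y k, fun _ => rfl, fun j hj hkj => absurd (edist_of_mem_outer (mem_level.1 hj) hkj) hk⟩
    choose y' hy'₁ hy'₂ using hex
    have hagree : ∀ j, S.graph.edist r j ≤ d → y' j = y j := fun j hj => hy'₁ j fun h => by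
      rw [h] at hj
      norm_cast at hj
      omega
    refine ⟨y', ?_, fun k hk => ?_, ?_⟩
    · rw [hagree r (by simp), hyr]
    · rw [hy'₁ k hk.ne', hy0 k (lt_trans (by exact_mod_cast Nat.lt_succ_self d) hk)]
    · rw [← hy, ← partialEnergy_congr hagree, ← sub_eq_zero, hu.partialEnergy_succ (by omega)]
      refine Finset.sum_eq_zero fun j hj => Finset.sum_eq_zero fun k hk => sub_eq_zero.2 ?_
      rw [hy'₂ k j hj hk, hagree j (mem_level.1 hj).le]
      exact message_quad_eq (S.jointR_posDef _ (adj_of_mem_outer hk)) (subtreeInfo_posDef hP hE h k) _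

end eliminate

/-! ### Comparison with the global cost -/

/-- No edge is counted twice: it cannot lead outward from both of its ends when the distances are
finite. -/
lemma sum_inside_outer_eq_sum_image (d : ℕ) (f : Sym2 V → ℝ) :
    ∑ j ∈ S.inside r d, ∑ k ∈ S.outer r j, f s(k, j) =
      ∑ e ∈ ((S.inside r d).sigma fun j => S.outer r j).image fun p => s(p.2, p.1), f e := by
  rw [Finset.sum_sigma', Finset.sum_image]
  rintro ⟨j, k⟩ hp ⟨j', k'⟩ hp' heq
  simp only [Finset.coe_sigma, Set.mem_sigma_iff, Finset.mem_coe, mem_inside] at hp hp'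
  rcases Sym2.eq_iff.1 heq with ⟨rfl, rfl⟩ | ⟨hk, hj⟩
  · rfl
  · dsimp only at hk hj
    subst hk hj
    exfalso
    have h₁ := (mem_outer.1 hp.2).2
    have h₂ := (mem_outer.1 hp'.2).2
    obtain ⟨m, hm⟩ := ENat.ne_top_iff_exists.1 hp'.1.ne_top
    rw [h₂, ← hm] at h₁
    norm_cast at h₁
    omega

lemma sum_edgeSet_eq (f : Sym2 V → ℝ) :
    ∑ e : S.graph.edgeSet, f e.1 = ∑ e ∈ S.graph.edgeFinset, f e := by
  rw [Finset.sum_subtype (p := fun e => e ∈ S.graph.edgeSet) _ fun e => SimpleGraph.mem_edgeFinset]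

lemma image_outer_subset (d : ℕ) :
    (((S.inside r d).sigma fun j => S.outer r j).image fun p => s(p.2, p.1)) ⊆
      S.graph.edgeFinset := by
  intro e he
  obtain ⟨⟨j, k⟩, hp, rfl⟩ := Finset.mem_image.1 he
  rw [SimpleGraph.mem_edgeFinset]
  exact adj_of_mem_outer (Finset.mem_sigma.1 hp).2

lemma sum_nodeEnergy_le_energy (hP : ∀ i, (S.localInfo i).PosDef) (d : ℕ)
    (y : (i : V) → Fin (S.dim i) → ℝ) :
    ∑ j ∈ S.inside r d, S.nodeEnergy r y j ≤ S.energy y := by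
  simp only [nodeEnergy]
  rw [Finset.sum_add_distrib, energy,
    sum_inside_outer_eq_sum_image d fun e => (S.jointR e)⁻¹.quad (S.jointValue e y),
    sum_edgeSet_eq fun e => (S.jointR e)⁻¹.quad (S.jointValue e y)]
  refine add_le_add ?_ ?_
  · exact Finset.sum_le_sum_of_subset_of_nonneg (Finset.subset_univ _)
      fun i _ _ => (hP i).quad_nonneg _
  · exact Finset.sum_le_sum_of_subset_of_nonneg (image_outer_subset d) fun e he _ =>
      (S.jointR_posDef e (SimpleGraph.mem_edgeFinset.1 he)).inv.quad_nonneg _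

/-- A neighbour on the same level would be a second non-outer neighbour besides the parent; at level
zero both ends would be `r`. -/
lemma UniqueInner.edist_ne (hu : S.UniqueInner r l) {j k : V} (h : S.graph.Adj j k)
    (hj : S.graph.edist r j ≤ l) : S.graph.edist r j ≠ S.graph.edist r k := by
  intro heq
  obtain ⟨m, hm⟩ := ENat.ne_top_iff_exists.1 (ne_top_of_le_ne_top (ENat.natCast_ne_top l) hj)
  cases m with
  | zero =>
    have h₁ : r = j := by simpa using hm.symm
    have h₂ : r = k := by simpa using heq.symm.trans hm.symm
    exact h.ne (h₁.symm.trans h₂)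
  | succ m =>
    obtain ⟨i, hadj, hi⟩ := SimpleGraph.exists_adj_edist_eq hm.symm
    have : k = i := hu hj h hadj heq.ge (by rw [hi, ← hm]; exact_mod_cast Nat.le_succ m)
    rw [← this, ← heq, ← hm] at hi
    norm_cast at hi
    omega

lemma UniqueInner.mem_outer_or (hu : S.UniqueInner r l) {j k : V} (h : S.graph.Adj j k)
    (hj : S.graph.edist r j ≤ l) : k ∈ S.outer r j ∨ j ∈ S.outer r k := by
  rcases lt_or_gt_of_ne (hu.edist_ne h hj) with hlt | hlt
  · exact .inl (mem_outer.2 ⟨h, le_antisymm (SimpleGraph.edist_le_edist_add_one_of_adj h)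
      (Order.add_one_le_of_lt hlt)⟩)
  · exact .inr (mem_outer.2 ⟨h.symm, le_antisymm (SimpleGraph.edist_le_edist_add_one_of_adj h.symm)
      (Order.add_one_le_of_lt hlt)⟩)

/-- An edge that does not lead outward from a node of the ball has both ends beyond distance `l`,
where the states vanish. -/
lemma UniqueInner.energy_eq (hu : S.UniqueInner r l) {y : (i : V) → Fin (S.dim i) → ℝ}
    (hy : ∀ k, l < S.graph.edist r k → y k = 0) :
    S.energy y = ∑ j ∈ S.inside r (l + 1), S.nodeEnergy r y j := by
  have hins {j : V} : j ∈ S.inside r (l + 1) ↔ S.graph.edist r j ≤ l := by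
    rw [mem_inside]
    push_cast
    exact Order.lt_add_one_iff_of_not_isMax (by simp)
  simp only [nodeEnergy]
  rw [Finset.sum_add_distrib, energy,
    sum_inside_outer_eq_sum_image _ fun e => (S.jointR e)⁻¹.quad (S.jointValue e y),
    sum_edgeSet_eq fun e => (S.jointR e)⁻¹.quad (S.jointValue e y)]
  congr 1
  · refine (Finset.sum_subset (Finset.subset_univ _) fun i _ hi => ?_).symm
    rw [hy i (not_le.1 (mt hins.2 hi)), quad_zero]
  · refine (Finset.sum_subset (image_outer_subset _) fun e he hne => ?_).symm
    induction e with
    | _ k j =>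
    have hadj : S.graph.Adj k j := SimpleGraph.mem_edgeFinset.1 he
    have hmem {j k : V} (hk : k ∈ S.outer r j) (hj : S.graph.edist r j ≤ l) :
        s(k, j) ∈ ((S.inside r (l + 1)).sigma fun j => S.outer r j).image fun p => s(p.2, p.1) :=
      Finset.mem_image.2 ⟨⟨j, k⟩, Finset.mem_sigma.2 ⟨hins.2 hj, hk⟩, rfl⟩
    have hout {j k : V} (h : S.graph.Adj k j)
        (hne : s(k, j) ∉ ((S.inside r (l + 1)).sigma fun j => S.outer r j).image
          fun p => s(p.2, p.1)) : y j = 0 := by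
      refine hy j (not_le.1 fun hj => hne ?_)
      rcases hu.mem_outer_or h.symm hj with hk | hk
      · exact hmem hk hj
      · rw [Sym2.eq_swap]
        refine hmem hk (le_trans ?_ hj)
        rw [(mem_outer.1 hk).2]
        exact le_self_add
    rw [jointValue_mk hadj, hout hadj hne, hout hadj.symm (by rwa [Sym2.eq_swap])]
    simp

lemma partialEnergy_zero_le_energy (hP : ∀ i, (S.localInfo i).PosDef)
    (y : (i : V) → Fin (S.dim i) → ℝ) : S.partialEnergy r 0 0 l y ≤ S.energy y := by
  refine le_trans ?_ (sum_nodeEnergy_le_energy (r := r) hP (l + 1) y)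
  rw [partialEnergy, sum_inside_succ]
  gcongr with j hj
  simp only [subtreeInfo, Pi.zero_apply, add_zero, nodeEnergy]
  rw [le_add_iff_nonneg_right]
  exact Finset.sum_nonneg fun k hk =>
    (S.jointR_posDef _ (adj_of_mem_outer hk)).inv.quad_nonneg _

/-- Setting the outside states to zero acts as if they were known, which is what `outerInfo` records
at the leaves. -/
lemma UniqueInner.energy_eq_partialEnergy_outerInfo (hu : S.UniqueInner r l)
    {y : (i : V) → Fin (S.dim i) → ℝ} (hy : ∀ k, l < S.graph.edist r k → y k = 0) :
    S.energy y = S.partialEnergy r (S.outerInfo r) 0 l y := by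
  rw [hu.energy_eq hy, partialEnergy, sum_inside_succ]
  congr 1
  refine Finset.sum_congr rfl fun j hj => ?_
  simp only [subtreeInfo, outerInfo, nodeEnergy, add_quad, sum_quad]
  congr 1
  refine Finset.sum_congr rfl fun k hk => ?_
  have hk0 : y k = 0 := hy k (by
    rw [edist_of_mem_outer (mem_level.1 hj) hk]
    exact_mod_cast Nat.lt_succ_self l)
  rw [jointValue_mk (adj_of_mem_outer hk), hk0, mulVec_zero, add_zero, edgeInfo,
    transpose_mul_mul_quad]

/-! ### The covariance of weighted least squares between two subtree recursions -/

lemma single_dotProduct (x : Fin (S.dim r) → ℝ) (y : S.Param → ℝ) :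
    (fun p => (Pi.single r x : (i : V) → Fin (S.dim i) → ℝ) p.1 p.2) ⬝ᵥ y =
      x ⬝ᵥ fun a => y ⟨r, a⟩ := by
  simp only [dotProduct, Fintype.sum_sigma]
  rw [Finset.sum_eq_single r]
  · simp
  · intro j _ hj
    simp [Pi.single_eq_of_ne hj]
  · simp

lemma submatrix_quad (A : Matrix S.Param S.Param ℝ) (x : Fin (S.dim r) → ℝ) :
    (A.submatrix (Sigma.mk r) (Sigma.mk r)).quad x =
      A.quad fun p => (Pi.single r x : (i : V) → Fin (S.dim i) → ℝ) p.1 p.2 := by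
  rw [quad, quad, single_dotProduct]
  congr 1
  ext a
  rw [mulVec, mulVec, dotProduct_comm, dotProduct_comm (A _), single_dotProduct]
  rfl

/-- The left side is the maximum over `y` of `2 x · y_r` minus the energy. The energy is at least
the root form without leaf information, so the maximum is at most the Fenchel maximum for that form.
-/
lemma UniqueInner.globalInfo_inv_quad_le (hP : ∀ i, (S.localInfo i).PosDef)
    (hu : S.UniqueInner r l) (x : Fin (S.dim r) → ℝ) :
    (S.globalInfo⁻¹.submatrix (Sigma.mk r) (Sigma.mk r)).quad x ≤
      (S.subtreeInfo r 0 l r)⁻¹.quad x := by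
  have h0 : ∀ j, ((0 : (j : V) → Matrix (Fin (S.dim j)) (Fin (S.dim j)) ℝ) j).PosSemidef :=
    fun _ => PosSemidef.zero
  rw [submatrix_quad, ← (globalInfo_posDef hP).two_mul_dotProduct_inv_sub_quad, single_dotProduct]
  set y := S.globalInfo⁻¹ *ᵥ fun p => (Pi.single r x : (i : V) → Fin (S.dim i) → ℝ) p.1 p.2
  refine le_trans ?_ ((subtreeInfo_posDef (r := r) hP h0 l r).two_mul_dotProduct_sub_quad_le x
    fun a => y ⟨r, a⟩)
  refine sub_le_sub_left ?_ _
  calc _ ≤ S.partialEnergy r 0 0 l fun i a => y ⟨i, a⟩ :=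
        hu.subtreeInfo_quad_le_partialEnergy hP h0 (add_zero l) fun i a => y ⟨i, a⟩
    _ ≤ S.energy fun i a => y ⟨i, a⟩ := partialEnergy_zero_le_energy hP _
    _ = S.globalInfo.quad y := (globalInfo_quad fun i a => y ⟨i, a⟩).symm

/-- The same maximum, bounded below at a trial state: the optimal one that vanishes outside the ball
and has the Fenchel maximizer at `r`. -/
lemma UniqueInner.le_globalInfo_inv_quad (hP : ∀ i, (S.localInfo i).PosDef)
    (hu : S.UniqueInner r l) (x : Fin (S.dim r) → ℝ) :
    (S.subtreeInfo r (S.outerInfo r) l r)⁻¹.quad x ≤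
      (S.globalInfo⁻¹.submatrix (Sigma.mk r) (Sigma.mk r)).quad x := by
  have hM := subtreeInfo_posDef (r := r) hP (S.outerInfo_posSemidef r) l r
  obtain ⟨y, hyr, hy0, hy⟩ := hu.exists_partialEnergy_eq hP (S.outerInfo_posSemidef r) (add_zero l)
    ((S.subtreeInfo r (S.outerInfo r) l r)⁻¹ *ᵥ x)
  have h := (globalInfo_posDef hP).two_mul_dotProduct_sub_quad_le
    (fun p => (Pi.single r x : (i : V) → Fin (S.dim i) → ℝ) p.1 p.2) (fun p => y p.1 p.2)
  rw [single_dotProduct, globalInfo_quad, hu.energy_eq_partialEnergy_outerInfo hy0, hy] at h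
  rw [submatrix_quad, ← hM.two_mul_dotProduct_inv_sub_quad, ← hyr]
  rwa [← hyr] at h

/-! ### The main estimate -/

/-- The bound of the main theorem, with an explicit constant and the rate `λ ≤ ρ`. -/
lemma norm_wlsCov_sub_inv_infoMatrix_le (hP : ∀ i, (S.localInfo i).PosDef)
    (hl : S.IsLoopFreeDepth r l) {Ω : Type*} [MeasurableSpace Ω] {P : Measure Ω}
    [IsProbabilityMeasure P] {v : S.Row → Ω → ℝ} (hv : S.IsNoise P v) (x : S.Param → ℝ) {N : ℕ}
    (hN : l + 1 ≤ N) :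
    ‖S.wlsCov P x v r - (S.infoMatrix r N)⁻¹‖ ≤
      2 * S.alpha₁ / S.beta₁ ^ 2 * S.lam ^ l := by
  have : Nonempty V := ⟨r⟩
  have hu := hl.uniqueInner
  have hū := hl.one_le_uBar
  have hα : 0 ≤ S.alpha₁ := alpha₁_nonneg (by linarith)
  have hβ := beta₁_pos hP
  have hlam := lam_nonneg hP (by linarith)
  have h0 : ∀ j, ((0 : (j : V) → Matrix (Fin (S.dim j)) (Fin (S.dim j)) ℝ) j).PosSemidef :=
    fun _ => PosSemidef.zero
  have hlo := subtreeInfo_posDef (r := r) hP h0 l r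
  have hhi := subtreeInfo_posDef (r := r) hP (S.outerInfo_posSemidef r) l r
  have hQ := infoMatrix_posDef hP r N
  have hQle := hu.subtreeInfo_quad_le_infoMatrix_quad hP hN
  set ε := 2 * S.lam ^ l * (S.alpha₁ / S.beta₁) with hε
  have hε0 : 0 ≤ ε := by positivity
  have hcontr : ∀ z, (S.subtreeInfo r (S.outerInfo r) l r).quad z ≤
      (1 + ε) * (S.subtreeInfo r 0 l r).quad z :=
    hu.subtreeInfo_outerInfo_quad_le hP (by linarith) one_le_two (d := 0) (by omega) (by simp)
      (by linarith [card_outer_self_le (S := S) r])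
  have hlo_inv (z : Fin (S.dim r) → ℝ) :
      (S.subtreeInfo r 0 l r)⁻¹.quad z ≤ 1 / S.beta₁ * (z ⬝ᵥ z) := by
    have h₁ := hlo.quad_inv_mulVec z
    set w := (S.subtreeInfo r 0 l r)⁻¹ *ᵥ z with hw
    have h₂ : S.beta₁ * (w ⬝ᵥ w) ≤ (S.subtreeInfo r 0 l r)⁻¹.quad z := by
      rw [← h₁]
      exact (beta₁_mul_le hP r w).trans (localInfo_quad_le_subtreeInfo_quad hP h0 l r w)
    have h₃ : (S.subtreeInfo r 0 l r)⁻¹.quad z = z ⬝ᵥ w := rfl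
    -- With `β₁ |w|² ≤ z · w`, expanding this square gives `β₁ (z · w) ≤ |z|²`.
    have h₄ : 0 ≤ (z - S.beta₁ • w) ⬝ᵥ (z - S.beta₁ • w) := by
      simpa using dotProduct_star_self_nonneg (z - S.beta₁ • w)
    simp only [sub_dotProduct, dotProduct_sub, smul_dotProduct, dotProduct_smul, smul_eq_mul,
      dotProduct_comm w z] at h₄
    rw [one_div_mul_eq_div, le_div_iff₀ hβ]
    rw [h₃] at h₂ ⊢
    nlinarith [mul_le_mul_of_nonneg_left h₂ hβ.le]
  rw [wlsCov_eq hP hv]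
  refine IsHermitian.norm_le_of_abs_quad_le ?_ (by positivity) fun z => ?_
  · exact ((globalInfo_posDef hP).inv.isHermitian.submatrix _).sub hQ.inv.isHermitian
  -- Both forms lie between the inverses of the upper and lower recursions (`h₁` to `h₄`), and `h₅`
  -- and `h₆` bound the length of that interval.
  have h₁ := hu.globalInfo_inv_quad_le hP z
  have h₂ := hu.le_globalInfo_inv_quad hP z
  have h₃ := hlo.inv_quad_le_inv_quad hQ (fun z => (hQle z).1) z
  have h₄ := hQ.inv_quad_le_inv_quad hhi (fun z => (hQle z).2) z
  have h₅ := hlo.inv_quad_sub_inv_quad_le hhi hε0 hcontr z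
  have h₆ : ε * (S.subtreeInfo r 0 l r)⁻¹.quad z ≤
      2 * S.alpha₁ / S.beta₁ ^ 2 * S.lam ^ l * (z ⬝ᵥ z) := by
    refine (mul_le_mul_of_nonneg_left (hlo_inv z) hε0).trans (le_of_eq ?_)
    rw [hε]
    field_simp
  rw [sub_quad, abs_le]
  constructor <;> linarith

lemma lam_le_rho (hP : ∀ i, (S.localInfo i).PosDef) (hl : S.IsLoopFreeDepth r l) :
    S.lam ≤ S.rho := by
  have : Nonempty V := ⟨r⟩
  have hū := hl.one_le_uBar
  exact le_mul_of_one_le_right (lam_nonneg hP (by linarith)) (Real.one_le_sqrt.2 hū)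

end SensorNetwork

end

theorem theorem1 :
    ∃ ϖ : (uBar : ℝ) → (nBar : ℕ) → (α₁ β₁ α₂ β₂ : ℝ) → ℝ,
      ∀ (V : Type*) [Fintype V] [DecidableEq V] (S : SensorNetwork V),
        (∀ i, (S.localInfo i).PosDef) →
        S.rho < 1 →
        ∀ (i : V) (l : ℕ), S.IsLoopFreeDepth i l →
        ∀ (Ω : Type*) [MeasurableSpace Ω] (P : Measure Ω) [IsProbabilityMeasure P]
          (v : S.Row → Ω → ℝ), S.IsNoise P v →
        ∀ (x : S.Param → ℝ) (N : ℕ), l + 1 ≤ N →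
          ‖S.wlsCov P x v i - (S.infoMatrix i N)⁻¹‖ ≤
            ϖ S.uBar S.nBar S.alpha₁ S.beta₁ S.alpha₂ S.beta₂ * S.rho ^ l := by
  -- The constant is the initial gap `α₁ / β₁`, doubled for the extra child of the root, times the
  -- bound `1 / β₁` on the inverse information.
  refine ⟨fun _ _ α₁ β₁ _ _ => 2 * α₁ / β₁ ^ 2, fun V _ _ S hP _ i l hl Ω _ P _ v hv x N hN => ?_⟩
  have : Nonempty V := ⟨i⟩
  have hū := hl.one_le_uBar
  have hα : 0 ≤ S.alpha₁ := SensorNetwork.alpha₁_nonneg (by linarith)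
  have hlam := SensorNetwork.lam_nonneg hP (by linarith)
  refine (SensorNetwork.norm_wlsCov_sub_inv_infoMatrix_le hP hl hv x hN).trans ?_
  gcongr
  exact SensorNetwork.lam_le_rho hP hl
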